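/- Let $\Bbbk$ be an algebraically closed field and $n\ge 1$ an integer. Let $\mathcal{C}_n$ be the monoid (under composition from right to left) of all maps $f:\{1,\dots,n\}\to\{1,\dots,n\}$ with $f(i)\le i$ for all $i$ and $f(i)\le f(j)$ whenever $i\le j$; for $1\le i\le n-1$ let $\alpha_i\in\mathcal{C}_n$ be the map sending $i+1$ to $i$ and fixing all other elements. Let $A$ be the $\Bbbk$-linear path category of the quiver $\mathbf{Q}$: $1\to 2\to\cdots\to n-1$ and let $A\text{-mod}$ be the category of finite dimensional left $A$-modules, that is, of covariant $\Bbbk$-linear functors from $A$ to finite dimensional vector spaces. Let $L_i$ be the simple top of the projective module $P_i=A(i,-)$, let $P=A(-,-)$ be the regular $A$-$A$-bimodule, and let $I=P^*$ be its $\Bbbk$-dual bimodule; as a left module, $I=\bigoplus_i I_i$, where $I_i=A(-,i)^*$ is the injective envelope of $L_i$. Let $\mathrm{F}_i$ be the endofunctor of $A\text{-mod}$ sending $M$ to $M/\mathrm{Tr}_{L_i}(M)$, where $\mathrm{Tr}_{L_i}(M)$ is the sum of the images of all homomorphisms $L_i\to M$; then $\mathrm{F}_iI$ is again an $A$-$A$-bimodule.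 Set $\mathrm{G}_i:=\mathrm{Hom}_A((\mathrm{F}_iI)^*,-)$, an endofunctor of $A\text{-mod}$. For a subbimodule $X\subseteq I$ and $1\le i\le n-1$ put $t_i:=0$ if $X\cap I_i=I_i$; otherwise let $t_i$ be the vertex such that the socle of $I_i/(X\cap I_i)$ is isomorphic to $L_{t_i}$. Let $\Theta_X\in\mathcal{C}_n$ be given by $\Theta_X(1)=1$ and $\Theta_X(i+1)=1+t_i$ for $1\le i\le n-1$. Let $f\in\mathcal{C}_n$ and let $f=\alpha_{i_1}\alpha_{i_2}\cdots\alpha_{i_k}$ be any decomposition of $f$ into a product of generators (with $k\geq 0$; the empty product is the identity). Then there is exactly one subbimodule $X$ of $I$ with $\Theta_X=f$, i.e. $X=\Theta^{-1}(f)$, and for this $X$ there is an isomorphism of endofunctors of $A\text{-mod}$ $$\mathrm{G}_{i_1}\circ\mathrm{G}_{i_2}\circ\cdots\circ\mathrm{G}_{i_k}\;\cong\;\mathrm{Hom}_A((I/X)^*,-),$$ where the empty composition is the identity functor. -/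

import Mathlib

open CategoryTheory Opposite

universe u

noncomputable section

namespace CatalanCat

/-! ### Finite dimensional modules over a `k`-linear category -/

section Modules

variable (k : Type u) [Field k] (C : Type) [Category.{u} C] [Preadditive C] [Linear k C]

/-- The finite dimensional left modules over a `k`-linear category `C`: covariant `k`-linear
functors from `C` to `k`-vector spaces, all of whose values are finite dimensional. -/
def isFDMod : ObjectProperty (C ⥤ ModuleCat.{u} k) := fun M =>
  M.Additive ∧ M.Linear k ∧ ∀ c, Module.Finite k (M.obj c)

/-- The category of finite dimensional left `C`-modules; morphisms are natural transformations. -/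
abbrev FDMod := (isFDMod k C).FullSubcategory

/-- The finite dimensional `C`-`C`-bimodules: `k`-linear functors `B` from `Cᵒᵖ` to left modules.
The value `(B.obj (op d)).obj.obj c` is contravariant in `d` (the right action)
and covariant in `c` (the left action). -/
def isFDBimod : ObjectProperty (Cᵒᵖ ⥤ FDMod k C) := fun B =>
  B.Additive ∧ ∀ {d e : C} (g : d ⟶ e) (r : k), B.map (r • g).op = r • B.map g.op

/-- The category of finite dimensional `C`-`C`-bimodules. -/
abbrev FDBimod := (isFDBimod k C).FullSubcategory

end Modules

section Submodules

variable {k : Type u} [Field k] {C : Type} [Category.{u} C] [Preadditive C] [Linear k C]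

/-- A submodule of a left `C`-module. -/
@[ext]
structure Submod (M : FDMod k C) where
  carrier (c : C) : Submodule k (M.obj.obj c)
  map_mem {c d : C} (f : c ⟶ d) {x : M.obj.obj c} (hx : x ∈ carrier c) :
    (M.obj.map f).hom x ∈ carrier d

namespace Submod

variable {M N : FDMod k C}

instance : PartialOrder (Submod M) := PartialOrder.lift carrier fun _ _ h => Submod.ext h

instance : OrderBot (Submod M) where
  bot := ⟨fun _ => ⊥, fun f x hx => by
    rw [Submodule.mem_bot] at hx
    simp [hx]⟩
  bot_le _ _ := bot_le

instance : OrderTop (Submod M) where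
  top := ⟨fun _ => ⊤, fun _ _ _ => Submodule.mem_top⟩
  le_top _ _ := le_top

/-- The sum of a family of submodules. -/
def sum {ι : Sort*} (S : ι → Submod M) : Submod M where
  carrier c := ⨆ a, (S a).carrier c
  map_mem {c d} f {x} hx := by
    have h : (⨆ a, (S a).carrier c) ≤ (⨆ a, (S a).carrier d).comap (M.obj.map f).hom :=
      iSup_le fun a _ hy => Submodule.mem_iSup_of_mem a ((S a).map_mem f hy)
    exact h hx

/-- The intersection of a family of submodules. -/
def inter {ι : Sort*} (S : ι → Submod M) : Submod M where
  carrier c := ⨅ a, (S a).carrier c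
  map_mem f x hx := by
    rw [Submodule.mem_iInf] at hx ⊢
    exact fun a => (S a).map_mem f (hx a)

/-- The image of a homomorphism. -/
def range (φ : M ⟶ N) : Submod N where
  carrier c := LinearMap.range (φ.hom.app c).hom
  map_mem f x hx := by
    obtain ⟨y, rfl⟩ := hx
    exact ⟨(M.obj.map f).hom y, NatTrans.naturality_apply φ.hom f y⟩

/-- A submodule, viewed as a module. -/
def toMod (S : Submod M) : FDMod k C where
  obj :=
    { obj := fun c => ModuleCat.of k (S.carrier c)
      map := fun f => ModuleCat.ofHom ((M.obj.map f).hom.restrict fun _ hx => S.map_mem f hx)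
      map_id := fun c => by ext x; simp
      map_comp := fun f g => by ext x; simp }
  property := by
    obtain ⟨hA, hL, hF⟩ := M.property
    refine ⟨⟨?_⟩, ⟨?_⟩, fun c => ?_⟩
    · intro c d f g; ext x; simp
    · intro c d f r; ext x; simp
    · have := hF c
      change Module.Finite k (S.carrier c)
      infer_instance

/-- The quotient of a module by a submodule. -/
def quot (S : Submod M) : FDMod k C where
  obj :=
    { obj := fun c => ModuleCat.of k (M.obj.obj c ⧸ S.carrier c)
      map := fun f => ModuleCat.ofHom
        (Submodule.mapQ _ _ (M.obj.map f).hom fun _ hx => S.map_mem f hx)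
      map_id := fun c => by ext x; simp
      map_comp := fun f g => by ext x; simp }
  property := by
    obtain ⟨hA, hL, hF⟩ := M.property
    refine ⟨⟨?_⟩, ⟨?_⟩, fun c => ?_⟩
    · intro c d f g; ext x; simp
    · intro c d f r; ext x; simp
    · have := hF c
      change Module.Finite k (M.obj.obj c ⧸ S.carrier c)
      infer_instance

/-- The map between quotients induced by a homomorphism that respects the submodules. -/
def quotMap (S : Submod M) (T : Submod N) (φ : M ⟶ N)
    (h : ∀ c, ∀ x ∈ S.carrier c, (φ.hom.app c).hom x ∈ T.carrier c) : S.quot ⟶ T.quot :=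
  ObjectProperty.homMk
    { app := fun c => ModuleCat.ofHom (Submodule.mapQ _ _ (φ.hom.app c).hom (h c))
      naturality := fun c d f => by
        ext x
        obtain ⟨x, rfl⟩ := Submodule.Quotient.mk_surjective _ x
        exact congrArg (T.carrier d).mkQ (NatTrans.naturality_apply φ.hom f x) }

lemma quot_hom_ext (S : Submod M) (φ ψ : S.quot ⟶ N)
    (h : ∀ c, ∀ x : M.obj.obj c,
      (φ.hom.app c).hom ((S.carrier c).mkQ x) = (ψ.hom.app c).hom ((S.carrier c).mkQ x)) :
    φ = ψ := by
  ext c x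
  obtain ⟨x, rfl⟩ := (S.carrier c).mkQ_surjective x
  exact h c x

end Submod

/-- The socle: the sum of all simple submodules. -/
def socle (M : FDMod k C) : Submod M := Submod.sum fun S : {S : Submod M // IsAtom S} => S.1

/-- The radical: the intersection of all maximal submodules. -/
def radical (M : FDMod k C) : Submod M :=
  Submod.inter fun S : {S : Submod M // IsCoatom S} => S.1

/-- The top of a module: its quotient by the radical. -/
def top (M : FDMod k C) : FDMod k C := (radical M).quot

/-- The trace of `L` in `N`: the sum of the images of all homomorphisms from `L` to `N`. -/
def trace (L N : FDMod k C) : Submod N := Submod.sum fun φ : L ⟶ N => Submod.range φ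

lemma trace_map (L : FDMod k C) {M N : FDMod k C} (ψ : M ⟶ N) (c : C) :
    ∀ x ∈ (trace L M).carrier c, (ψ.hom.app c).hom x ∈ (trace L N).carrier c := by
  have h : (trace L M).carrier c ≤ ((trace L N).carrier c).comap (ψ.hom.app c).hom := by
    refine iSup_le fun φ => ?_
    rintro _ ⟨y, rfl⟩
    exact Submodule.mem_iSup_of_mem (p := fun φ : L ⟶ N => (Submod.range φ).carrier c)
      (φ ≫ ψ) ⟨y, rfl⟩
  exact h

/-- The quotient of the identity functor by the trace of `L`, that is `M ↦ M / Tr_L(M)`. -/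
def quotTrace (L : FDMod k C) : FDMod k C ⥤ FDMod k C where
  obj M := (trace L M).quot
  map ψ := Submod.quotMap _ _ ψ (trace_map L ψ)
  map_id M := by
    ext c x
    obtain ⟨x, rfl⟩ := Submodule.Quotient.mk_surjective _ x
    rfl
  map_comp φ ψ := by
    ext c x
    obtain ⟨x, rfl⟩ := Submodule.Quotient.mk_surjective _ x
    rfl

instance (L : FDMod k C) : (quotTrace L).Additive where
  map_add {M N φ ψ} := by
    ext c x
    obtain ⟨x, rfl⟩ := Submodule.Quotient.mk_surjective _ x
    rfl

instance (L : FDMod k C) : (quotTrace L).Linear k where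
  map_smul {M N} φ r := by
    ext c x
    obtain ⟨x, rfl⟩ := Submodule.Quotient.mk_surjective _ x
    rfl

/-- A functor on left modules applied to a bimodule; the right action is transported by
functoriality. -/
def applyFunctor (F : FDMod k C ⥤ FDMod k C) [F.Additive] [F.Linear k] (B : FDBimod k C) :
    FDBimod k C where
  obj := B.obj ⋙ F
  property := by
    obtain ⟨hA, hL⟩ := B.property
    refine ⟨inferInstance, fun g r => ?_⟩
    rw [Functor.comp_map, Functor.comp_map, hL, F.map_smul]

/-- A subbimodule of a bimodule `B`: a submodule of the left module `B(-,d)` for every `d`,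
such that the right action maps these submodules to each other. -/
@[ext]
structure SubBimod (B : FDBimod k C) where
  left (d : C) : Submod (B.obj.obj (op d))
  right_mem {d d' : C} (g : d' ⟶ d) (c : C) {x : (B.obj.obj (op d)).obj.obj c}
    (hx : x ∈ (left d).carrier c) : ((B.obj.map g.op).hom.app c).hom x ∈ (left d').carrier c

/-- The quotient of a bimodule by a subbimodule. -/
def SubBimod.quot {B : FDBimod k C} (X : SubBimod B) : FDBimod k C where
  obj :=
    { obj := fun d => (X.left d.unop).quot
      map := fun g => Submod.quotMap _ _ (B.obj.map g) fun c _ hx => X.right_mem g.unop c hx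
      map_id := fun d => by
        ext c x
        obtain ⟨x, rfl⟩ := Submodule.Quotient.mk_surjective _ x
        change Submodule.Quotient.mk (((B.obj.map (𝟙 d)).hom.app c).hom x) = _
        rw [B.obj.map_id]
        rfl
      map_comp := fun f g => by
        ext c x
        obtain ⟨x, rfl⟩ := Submodule.Quotient.mk_surjective _ x
        change Submodule.Quotient.mk (((B.obj.map (f ≫ g)).hom.app c).hom x) = _
        rw [B.obj.map_comp]
        rfl }
  property := by
    obtain ⟨hA, hL⟩ := B.property
    refine ⟨⟨fun {d e f g} => ?_⟩, fun g r => ?_⟩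
    · refine Submod.quot_hom_ext _ _ _ fun c x => ?_
      exact congrArg (fun φ : B.obj.obj d ⟶ B.obj.obj e =>
        ((X.left e.unop).carrier c).mkQ ((φ.hom.app c).hom x)) (B.obj.map_add (f := f) (g := g))
    · refine Submod.quot_hom_ext _ _ _ fun c x => ?_
      exact congrArg (fun φ : B.obj.obj (op _) ⟶ B.obj.obj (op _) =>
        ((X.left _).carrier c).mkQ ((φ.hom.app c).hom x)) (hL g r)

/-- The left module `B^*(-, d) = B(d, -)^*`, with the left action induced by the right action
on `B`. -/
def dualLeft (B : FDBimod k C) (d : C) : FDMod k C where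
  obj :=
    { obj := fun c => ModuleCat.of k (Module.Dual k ((B.obj.obj (op c)).obj.obj d))
      map := fun f => ModuleCat.ofHom (Module.Dual.transpose ((B.obj.map f.op).hom.app d).hom)
      map_id := fun c => by
        refine ModuleCat.hom_ext (LinearMap.ext fun ξ => LinearMap.ext fun x => ?_)
        exact congrArg (fun φ : B.obj.obj (op c) ⟶ B.obj.obj (op c) =>
          ξ ((φ.hom.app d).hom x)) (B.obj.map_id (op c))
      map_comp := fun {a b c} f g => by
        refine ModuleCat.hom_ext (LinearMap.ext fun ξ => LinearMap.ext fun x => ?_)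
        exact congrArg (fun φ : B.obj.obj (op c) ⟶ B.obj.obj (op a) =>
          ξ ((φ.hom.app d).hom x)) (B.obj.map_comp g.op f.op) }
  property := by
    obtain ⟨hA, hL⟩ := B.property
    refine ⟨⟨fun {c e f g} => ?_⟩, ⟨fun {c e} f r => ?_⟩, fun c => ?_⟩
    · refine ModuleCat.hom_ext (LinearMap.ext fun ξ => LinearMap.ext fun x => ?_)
      exact (congrArg (fun φ : B.obj.obj (op e) ⟶ B.obj.obj (op c) =>
        ξ ((φ.hom.app d).hom x)) (B.obj.map_add (f := f.op) (g := g.op))).trans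
        (map_add ξ _ _)
    · refine ModuleCat.hom_ext (LinearMap.ext fun ξ => LinearMap.ext fun x => ?_)
      exact (congrArg (fun φ : B.obj.obj (op e) ⟶ B.obj.obj (op c) =>
        ξ ((φ.hom.app d).hom x)) (hL f r)).trans (map_smul ξ r _)
    · have := (B.obj.obj (op c)).property.2.2 d
      change Module.Finite k (Module.Dual k ((B.obj.obj (op c)).obj.obj d))
      infer_instance

/-- The `k`-dual of a bimodule: `B^*(c, d) = B(d, c)^*`, with the right action induced by the
left action on `B`. -/
def dual (B : FDBimod k C) : FDBimod k C where
  obj :=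
    { obj := fun d => dualLeft B d.unop
      map := fun {d e} g => ObjectProperty.homMk
        { app := fun c => ModuleCat.ofHom
            (Module.Dual.transpose ((B.obj.obj (op c)).obj.map g.unop).hom)
          naturality := fun c c' f => by
            refine ModuleCat.hom_ext (LinearMap.ext fun (ξ : Module.Dual k _) => LinearMap.ext fun x => ?_)
            exact congrArg (ξ : Module.Dual k ((B.obj.obj (op c)).obj.obj d.unop)) (NatTrans.naturality_apply (B.obj.map f.op).hom g.unop x) }
      map_id := fun d => by
        refine ObjectProperty.hom_ext _ (NatTrans.ext (funext fun c =>
          ModuleCat.hom_ext (LinearMap.ext fun (ξ : Module.Dual k _) => LinearMap.ext fun x => ?_)))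
        exact congrArg (fun φ : (B.obj.obj (op c)).obj.obj d.unop ⟶
          (B.obj.obj (op c)).obj.obj d.unop => ξ (φ.hom x)) ((B.obj.obj (op c)).obj.map_id d.unop)
      map_comp := fun {a b d} f g => by
        refine ObjectProperty.hom_ext _ (NatTrans.ext (funext fun c =>
          ModuleCat.hom_ext (LinearMap.ext fun (ξ : Module.Dual k _) => LinearMap.ext fun x => ?_)))
        exact congrArg (fun φ : (B.obj.obj (op c)).obj.obj d.unop ⟶
          (B.obj.obj (op c)).obj.obj a.unop => ξ (φ.hom x)) ((B.obj.obj (op c)).obj.map_comp g.unop f.unop) }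
  property := by
    refine ⟨⟨fun {d e f g} => ?_⟩, fun {d e} g r => ?_⟩
    · refine ObjectProperty.hom_ext _ (NatTrans.ext (funext fun c =>
        ModuleCat.hom_ext (LinearMap.ext fun (ξ : Module.Dual k _) => LinearMap.ext fun x => ?_)))
      have := (B.obj.obj (op c)).property.1
      exact (congrArg (fun φ : (B.obj.obj (op c)).obj.obj e.unop ⟶
          (B.obj.obj (op c)).obj.obj d.unop => ξ (φ.hom x))
        ((B.obj.obj (op c)).obj.map_add (f := f.unop) (g := g.unop))).trans (map_add ξ _ _)
    · refine ObjectProperty.hom_ext _ (NatTrans.ext (funext fun c =>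
        ModuleCat.hom_ext (LinearMap.ext fun (ξ : Module.Dual k _) => LinearMap.ext fun x => ?_)))
      have := (B.obj.obj (op c)).property.2.1
      exact (congrArg (fun φ : (B.obj.obj (op c)).obj.obj d ⟶
          (B.obj.obj (op c)).obj.obj e => ξ (φ.hom x))
        ((B.obj.obj (op c)).obj.map_smul r g)).trans (map_smul ξ r _)

/-- Homomorphism spaces between finite dimensional modules are finite dimensional. -/
lemma finite_hom [Finite C] (M N : FDMod k C) : Module.Finite k (M ⟶ N) := by
  have (c : C) : Module.Finite k (M.obj.obj c) := M.property.2.2 c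
  have (c : C) : Module.Finite k (N.obj.obj c) := N.property.2.2 c
  let Φ : (M ⟶ N) →ₗ[k] ∀ c, M.obj.obj c →ₗ[k] N.obj.obj c :=
    { toFun := fun φ c => (φ.hom.app c).hom
      map_add' := fun _ _ => rfl
      map_smul' := fun _ _ => rfl }
  refine Module.Finite.of_injective Φ fun φ ψ h => ?_
  ext c x
  exact LinearMap.congr_fun (congrFun h c) x

/-- The endofunctor `Hom_C(B, -)` of the category of finite dimensional left modules: the value
of `Hom_C(B, M)` at `d` is the space of homomorphisms of left modules from `B(-, d)` to `M`, and
the left action on it is induced by the right action on `B`. -/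
def homFunctor [Finite C] (B : FDBimod k C) : FDMod k C ⥤ FDMod k C where
  obj M :=
    { obj :=
        { obj := fun d => ModuleCat.of k (B.obj.obj (op d) ⟶ M)
          map := fun g => ModuleCat.ofHom (Linear.leftComp k M (B.obj.map g.op))
          map_id := fun d => by
            refine ModuleCat.hom_ext (LinearMap.ext fun φ => ?_)
            exact (congrArg (· ≫ φ) (B.obj.map_id (op d))).trans (Category.id_comp φ)
          map_comp := fun f g => by
            refine ModuleCat.hom_ext (LinearMap.ext fun φ => ?_)
            exact (congrArg (· ≫ φ) (B.obj.map_comp g.op f.op)).trans (Category.assoc _ _ φ) }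
      property := by
        obtain ⟨hA, hL⟩ := B.property
        refine ⟨⟨fun {d e f g} => ?_⟩, ⟨fun f r => ?_⟩, fun d => finite_hom (B.obj.obj (op d)) M⟩
        · refine ModuleCat.hom_ext (LinearMap.ext fun φ => ?_)
          exact (congrArg (· ≫ φ) (B.obj.map_add (f := f.op) (g := g.op))).trans
            (Preadditive.add_comp _ _ _ _ _ φ)
        · refine ModuleCat.hom_ext (LinearMap.ext fun φ => ?_)
          exact (congrArg (· ≫ φ) (hL f r)).trans (Linear.smul_comp _ _ _ r _ φ) }
  map ψ := ObjectProperty.homMk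
    { app := fun d => ModuleCat.ofHom (Linear.rightComp k (B.obj.obj (op d)) ψ)
      naturality := fun d e g => by
        refine ModuleCat.hom_ext (LinearMap.ext fun φ => ?_)
        exact Category.assoc (B.obj.map g.op) φ ψ }
  map_id M := by
    refine ObjectProperty.hom_ext _ (NatTrans.ext (funext fun d =>
      ModuleCat.hom_ext (LinearMap.ext fun φ => ?_)))
    exact Category.comp_id (X := B.obj.obj (op d)) φ
  map_comp χ ψ := by
    refine ObjectProperty.hom_ext _ (NatTrans.ext (funext fun d =>
      ModuleCat.hom_ext (LinearMap.ext fun φ => ?_)))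
    exact (Category.assoc (W := B.obj.obj (op d)) φ χ ψ).symm

section HomFinite

variable (k C) [∀ c d : C, Module.Finite k (c ⟶ d)]

/-- The projective module `P_c = C(c, -)`. -/
def proj (c : C) : FDMod k C where
  obj :=
    { obj := fun d => ModuleCat.of k (c ⟶ d)
      map := fun f => ModuleCat.ofHom (Linear.rightComp k c f)
      map_id := fun d => ModuleCat.hom_ext (LinearMap.ext fun x => Category.comp_id x)
      map_comp := fun f g =>
        ModuleCat.hom_ext (LinearMap.ext fun x => (Category.assoc x f g).symm) }
  property := by
    refine ⟨⟨fun {d e f g} => ?_⟩, ⟨fun f r => ?_⟩, fun d => ?_⟩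
    · exact ModuleCat.hom_ext (LinearMap.ext fun x => Preadditive.comp_add _ _ _ x f g)
    · exact ModuleCat.hom_ext (LinearMap.ext fun x => Linear.comp_smul _ _ _ x r f)
    · change Module.Finite k (c ⟶ d)
      infer_instance

/-- The simple module `L_c`, the top of `P_c`. -/
def simple (c : C) : FDMod k C := top (proj k C c)

/-- The bimodule `P = C(-, -)`, with `P(c, d) = C(d, c)`. -/
def regularBimod : FDBimod k C where
  obj :=
    { obj := fun d => proj k C d.unop
      map := fun {d e} g => ObjectProperty.homMk
        { app := fun c => ModuleCat.ofHom (Linear.leftComp k c g.unop)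
          naturality := fun c c' f => by
            exact ModuleCat.hom_ext (LinearMap.ext fun x =>
              (Category.assoc g.unop x f).symm) }
      map_id := fun d => by
        refine ObjectProperty.hom_ext _ (NatTrans.ext (funext fun c =>
          ModuleCat.hom_ext (LinearMap.ext fun x => ?_)))
        exact Category.id_comp (X := d.unop) x
      map_comp := fun f g => by
        refine ObjectProperty.hom_ext _ (NatTrans.ext (funext fun c =>
          ModuleCat.hom_ext (LinearMap.ext fun x => ?_)))
        exact Category.assoc g.unop f.unop x }
  property := by
    refine ⟨⟨fun {d e f g} => ?_⟩, fun g r => ?_⟩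
    · refine ObjectProperty.hom_ext _ (NatTrans.ext (funext fun c =>
        ModuleCat.hom_ext (LinearMap.ext fun x => ?_)))
      exact Preadditive.add_comp _ _ _ f.unop g.unop x
    · refine ObjectProperty.hom_ext _ (NatTrans.ext (funext fun c =>
        ModuleCat.hom_ext (LinearMap.ext fun x => ?_)))
      exact Linear.smul_comp _ _ _ r g x

/-- The bimodule `I = P^*`. Its part `I(-, c)` is the injective left module
`I_c = C(-, c)^*`. -/
def injBimod : FDBimod k C := dual (regularBimod k C)

/-- The injective left module `I_c = C(-, c)^*`, a direct summand of the left module `I`. -/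
abbrev inj (c : C) : FDMod k C := (injBimod k C).obj.obj (op c)

/-- The projection functor `F_c = Id / Tr_{L_c}`. -/
abbrev projFunctor (c : C) : FDMod k C ⥤ FDMod k C := quotTrace (simple k C c)

/-- The functor `G_c = Hom_C((F_c I)^*, -)`. -/
def functorG [Finite C] (c : C) : FDMod k C ⥤ FDMod k C :=
  homFunctor (dual (applyFunctor (projFunctor k C c) (injBimod k C)))

/-- The composition `G_{c_1} ∘ ⋯ ∘ G_{c_r}` (the functor `G_{c_r}` is applied first); the empty
composition is the identity functor. -/
def compG [Finite C] : List C → (FDMod k C ⥤ FDMod k C)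
  | [] => 𝟭 _
  | c :: l => compG l ⋙ functorG k C c

end HomFinite

end Submodules

/-! ### Path categories -/

section Paths

/-- The `k`-linear path category of a quiver. -/
abbrev PathCat (k : Type u) [Field k] (Γ : Type) [Quiver.{0} Γ] := Free k (Paths Γ)

instance (k : Type u) [Field k] (Γ : Type) [Quiver.{0} Γ] [h : Finite Γ] :
    Finite (PathCat k Γ) := h

instance (k : Type u) [Field k] (Γ : Type) [Quiver.{0} Γ] [h : ∀ a b : Γ, Finite (Quiver.Path a b)]
    (a b : PathCat k Γ) : Module.Finite k (a ⟶ b) := by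
  have := h a b
  exact (inferInstance : Module.Finite k (Quiver.Path (V := Γ) a b →₀ k))

end Paths

/-! ### The linear quiver and the Catalan monoid -/

/-- The set `{1, 2, …, m}`. -/
abbrev NN (m : ℕ) : Type := Set.Icc 1 m

/-- The vertices `1, 2, …, m` of the linear quiver `1 ⟶ 2 ⟶ ⋯ ⟶ m`. -/
structure LinQuiver (m : ℕ) : Type where
  vertex : NN m

/-- There is exactly one arrow from `i` to `i + 1`, and there are no other arrows. -/
instance (m : ℕ) : Quiver.{0} (LinQuiver m) where
  Hom i j := PLift ((i.vertex : ℕ) + 1 = j.vertex)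

instance (m : ℕ) : Finite (LinQuiver m) :=
  Finite.of_injective LinQuiver.vertex fun ⟨_⟩ ⟨_⟩ h => congrArg _ h

lemma LinQuiver.length_eq {m : ℕ} {i j : LinQuiver m} (p : Quiver.Path i j) :
    (i.vertex : ℕ) + p.length = j.vertex := by
  induction p with
  | nil => rfl
  | cons p e ih => rw [Quiver.Path.length_cons, ← add_assoc, ih]; exact e.down

instance (m : ℕ) (i j : LinQuiver m) : Subsingleton (Quiver.Path i j) where
  allEq p q := by
    induction p with
    | nil =>
      cases q with
      | nil => rfl
      | cons q e =>
        have h := LinQuiver.length_eq (q.cons e)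
        simp at h
    | @cons b c p e ih =>
      cases q with
      | nil =>
        have h := LinQuiver.length_eq (p.cons e)
        simp at h
      | @cons b' _ q e' =>
        obtain ⟨⟨b, hb⟩⟩ := b
        obtain ⟨⟨b', hb'⟩⟩ := b'
        have h1 := e.down
        have h2 := e'.down
        simp only at h1 h2
        obtain rfl : b = b' := by omega
        rw [ih q]
        exact congrArg (Quiver.Path.cons q) (congrArg PLift.up (Subsingleton.elim e.down e'.down))

/-- The Catalan monoid: the order-decreasing and order-preserving maps from `{1, …, n}` to
itself, with composition from right to left. -/
def catalanMonoid (n : ℕ) : Submonoid (Function.End (NN n)) where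
  carrier := {f | (∀ i, f i ≤ i) ∧ ∀ i j, i ≤ j → f i ≤ f j}
  one_mem' := ⟨fun _ => le_rfl, fun _ _ h => h⟩
  mul_mem' {_ g} hf hg :=
    ⟨fun i => (hf.1 (g i)).trans (hg.1 i), fun i j h => hf.2 _ _ (hg.2 i j h)⟩

/-- The generator `α_i` for `1 ≤ i ≤ n - 1`: it sends `i + 1` to `i` and fixes every other
element. -/
def alpha {n : ℕ} (i : NN (n - 1)) : catalanMonoid n where
  val j := if h : (j : ℕ) = i + 1 then ⟨j - 1, by
    have h1 := i.2.1
    have h2 := j.2.2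
    constructor <;> omega⟩ else j
  property := by
    constructor
    · intro j
      beta_reduce
      rw [← Subtype.coe_le_coe]
      split_ifs
      · exact Nat.sub_le _ _
      · exact le_rfl
    · intro j l h
      beta_reduce
      rw [← Subtype.coe_le_coe] at h ⊢
      split_ifs <;> (try simp only) <;> omega

/-- The `k`-linear path category of the quiver `1 ⟶ 2 ⟶ ⋯ ⟶ n - 1`. -/
abbrev linCat (k : Type u) [Field k] (n : ℕ) := PathCat k (LinQuiver (n - 1))

/-- The vertex `i`, as an object of the path category. -/
abbrev vert (k : Type u) [Field k] {n : ℕ} (i : NN (n - 1)) : linCat k n :=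
  (LinQuiver.mk i : LinQuiver (n - 1))

/-- For a subbimodule `X` of `I` and a vertex `i`, this says that `t = t_i`: either
`X ∩ I_i = I_i` and `t = 0`, or `X ∩ I_i ≠ I_i` and `t` is the vertex such that the socle of
`I_i / (X ∩ I_i)` is isomorphic to `L_t`. -/
def IsSocleIndex {k : Type u} [Field k] {n : ℕ} (X : SubBimod (injBimod k (linCat k n)))
    (i : NN (n - 1)) (t : ℕ) : Prop :=
  (X.left (vert k i) = ⊤ ∧ t = 0) ∨
    (X.left (vert k i) ≠ ⊤ ∧ ∃ v : NN (n - 1), (v : ℕ) = t ∧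
      Nonempty ((socle (X.left (vert k i)).quot).toMod ≅ simple k (linCat k n) (vert k v)))

/-- The relation `Θ_X = f` between a subbimodule `X` of `I` and an element `f` of the Catalan
monoid: `f(1) = 1` and `f(i + 1) = 1 + t_i` for all vertices `i`. -/
def ThetaEq {k : Type u} [Field k] {n : ℕ} (X : SubBimod (injBimod k (linCat k n)))
    (f : catalanMonoid n) : Prop :=
  (∀ j : NN n, (j : ℕ) = 1 → (f.1 j : ℕ) = 1) ∧
    ∀ (i : NN (n - 1)) (j : NN n), (j : ℕ) = i + 1 →
      ∃ t, IsSocleIndex X i t ∧ (f.1 j : ℕ) = 1 + t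

end CatalanCat

end

noncomputable section

namespace CatalanCat


/-! ### Modules over the path category of the linear quiver -/

/-! There is one path from `c` to `d` if `c ≤ d` and none otherwise, so a module is a chain of
vector spaces, and `I_c` is a line at each `d ≤ c`, zero above `c`, with injective maps between its
lines. A submodule of `I_c` is therefore fixed by a threshold `s ≤ c`: it vanishes up to `s` and is
everything above (`exists_isCut`). The quotient is zero if `s = 0` and has socle `L_s` otherwise, so
`t_c` is exactly this threshold (`isSocleIndex_iff`). Hence `Θ_X = f` prescribes all thresholds,
namely `theta f c = f(c+1) - 1`, and so determines `X`; conversely, monotone thresholds define a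
subbimodule (`existsUnique_thetaEq`).

Let `t` be the thresholds of `X`. The module `(I/X)^*(-, d)` has one basis vector at each `c` with
`d ≤ t c`, and paths carry these vectors to one another. Homomorphisms from it to `M` are therefore
compatible families in `M`, that is, the limit of `M` over `{c | d ≤ t c}` (`pullDataQuot`).
`PullData t H` says that `H` has this description, naturally in the module and the vertex; it
determines `H` up to isomorphism (`PullData.natIso`).

Each `G_v` is of this kind, because `F_v I` is `I` modulo the traces of `L_v`, whose thresholds are
`theta (alpha v)` (`isCut_trace`). Iterated limits are limits again (`PullData.trans`), and the
index sets combine exactly as thresholds do under multiplication in the Catalan monoid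
(`le_theta_mul_iff`). So the composite of the `G`'s and `Hom((I/X)^*, -)` are both described by
`theta f`, whichever word represents `f`. -/

lemma LinQuiver.nonempty_path {m : ℕ} {i j : LinQuiver m} (h : i.vertex ≤ j.vertex) :
    Nonempty (Quiver.Path i j) := by
  obtain ⟨⟨i, hi⟩⟩ := i
  obtain ⟨⟨j, hj⟩⟩ := j
  change i ≤ j at h
  induction j, h using Nat.le_induction with
  | base => exact ⟨.nil⟩
  | succ j hij ih =>
    obtain ⟨p⟩ := ih ⟨hi.1.trans hij, (Nat.le_succ j).trans hj.2⟩
    exact ⟨p.cons ⟨rfl⟩⟩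

section LinMod

variable {k : Type u} [Field k] {n : ℕ}

variable (k) in
/-- The unique path between two vertices, as a morphism of the path category. -/
def arr {c d : NN (n - 1)} (h : c ≤ d) : vert k c ⟶ vert k d :=
  (Finsupp.single (LinQuiver.nonempty_path (i := ⟨c⟩) (j := ⟨d⟩) h).some (1 : k) :
    Quiver.Path (LinQuiver.mk c) (LinQuiver.mk d) →₀ k)

lemma arr_refl (c : NN (n - 1)) : arr k (le_refl c) = 𝟙 (vert k c) := by
  refine congrArg (fun p => (Finsupp.single p (1 : k) :
    Quiver.Path (LinQuiver.mk c) (LinQuiver.mk c) →₀ k)) ?_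
  exact Subsingleton.elim _ _

lemma arr_comp {c d e : NN (n - 1)} (h : c ≤ d) (h' : d ≤ e) :
    arr k h ≫ arr k h' = arr k (h.trans h') := by
  refine (Free.single_comp_single (R := k) (C := Paths (LinQuiver (n - 1))) _ _ 1 1).trans ?_
  rw [mul_one]
  refine congrArg (fun p => (Finsupp.single p (1 : k) :
    Quiver.Path (LinQuiver.mk c) (LinQuiver.mk e) →₀ k)) ?_
  exact Subsingleton.elim _ _

/-- The coefficient of a morphism at the unique path. -/
def coeff {c d : NN (n - 1)} (h : c ≤ d) : (vert k c ⟶ vert k d) →ₗ[k] k :=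
  Finsupp.lapply (M := k)
    ((LinQuiver.nonempty_path (i := ⟨c⟩) (j := ⟨d⟩) h).some :
      Quiver.Path (LinQuiver.mk c) (LinQuiver.mk d))

lemma coeff_arr {c d : NN (n - 1)} (h : c ≤ d) : coeff h (arr k h) = 1 :=
  Finsupp.single_eq_same

/-- Paths with given endpoints are unique, so each hom space is at most a line. This reduces
naturality and stability conditions to the single maps `act`. -/
lemma eq_coeff_smul_arr {c d : NN (n - 1)} (h : c ≤ d) (g : vert k c ⟶ vert k d) :
    g = coeff h g • arr k h := by
  refine Finsupp.ext (M := k)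
    (α := Quiver.Path (LinQuiver.mk c) (LinQuiver.mk d)) fun p => ?_
  obtain rfl : (LinQuiver.nonempty_path (i := ⟨c⟩) (j := ⟨d⟩) h).some = p :=
    Subsingleton.elim _ _
  refine Eq.trans ?_ (Finsupp.smul_apply (M := k) _ _ _).symm
  have := coeff_arr (k := k) h
  change coeff h g = coeff h g • coeff h (arr k h)
  rw [this, smul_eq_mul, mul_one]

lemma hom_eq_zero {c d : NN (n - 1)} (h : ¬ c ≤ d) (g : vert k c ⟶ vert k d) : g = 0 := by
  refine Finsupp.ext (M := k)
    (α := Quiver.Path (LinQuiver.mk c) (LinQuiver.mk d)) fun p => (h ?_).elim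
  have := LinQuiver.length_eq p
  exact Subtype.coe_le_coe.mp (this ▸ Nat.le_add_right _ _)

/-- The value of a module at a vertex. -/
abbrev val (M : FDMod k (linCat k n)) (c : NN (n - 1)) : ModuleCat.{u} k :=
  M.obj.obj (vert k c)

/-- The action of the unique path between two vertices on a module. -/
def act (M : FDMod k (linCat k n)) {c d : NN (n - 1)} (h : c ≤ d) : val M c →ₗ[k] val M d :=
  (M.obj.map (arr k h)).hom

lemma act_refl (M : FDMod k (linCat k n)) {c : NN (n - 1)} (x : val M c) :
    act M (le_refl c) x = x := by
  rw [act, arr_refl, M.obj.map_id]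
  rfl

lemma act_act (M : FDMod k (linCat k n)) {c d e : NN (n - 1)} (h : c ≤ d) (h' : d ≤ e)
    (x : val M c) : act M h' (act M h x) = act M (h.trans h') x := by
  rw [act, act, act, ← arr_comp h h', M.obj.map_comp]
  rfl

lemma map_apply (M : FDMod k (linCat k n)) {c d : NN (n - 1)} (h : c ≤ d)
    (g : vert k c ⟶ vert k d) (x : val M c) :
    (M.obj.map g).hom x = coeff h g • act M h x := by
  have := M.property.2.1
  conv_lhs => rw [eq_coeff_smul_arr h g, Functor.map_smul]
  rfl

lemma map_apply_of_not_le (M : FDMod k (linCat k n)) {c d : NN (n - 1)} (h : ¬ c ≤ d)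
    (g : vert k c ⟶ vert k d) (x : val M c) : (M.obj.map g).hom x = 0 := by
  have := M.property.1
  rw [hom_eq_zero h g, Functor.map_zero]
  rfl

/-- The component of a homomorphism at a vertex. -/
abbrev comp {M N : FDMod k (linCat k n)} (φ : M ⟶ N) (c : NN (n - 1)) :
    val M c →ₗ[k] val N c :=
  (φ.hom.app (vert k c)).hom

lemma comp_act {M N : FDMod k (linCat k n)} (φ : M ⟶ N) {c d : NN (n - 1)} (h : c ≤ d)
    (x : val M c) : comp φ d (act M h x) = act N h (comp φ c x) :=
  NatTrans.naturality_apply φ.hom (arr k h) x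

/-- A homomorphism is a family of linear maps that commute with the paths. -/
def homOfAct {M N : FDMod k (linCat k n)} (φ : ∀ c, val M c →ₗ[k] val N c)
    (hφ : ∀ {c d : NN (n - 1)} (h : c ≤ d) (x : val M c), φ d (act M h x) = act N h (φ c x)) :
    M ⟶ N :=
  ObjectProperty.homMk
    { app := fun c => ModuleCat.ofHom (φ (LinQuiver.vertex c))
      naturality := fun c d g => by
        refine ModuleCat.hom_ext (LinearMap.ext fun x => ?_)
        change φ (LinQuiver.vertex d) ((M.obj.map g).hom x) =
          (N.obj.map g).hom (φ (LinQuiver.vertex c) x)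
        by_cases h : LinQuiver.vertex c ≤ LinQuiver.vertex d
        · refine (congrArg _ (map_apply M h g x)).trans ?_
          refine Eq.trans ?_ (map_apply N h g _).symm
          exact (map_smul _ _ _).trans (congrArg _ (hφ h x))
        · refine (congrArg _ (map_apply_of_not_le M h g x)).trans ?_
          refine Eq.trans ?_ (map_apply_of_not_le N h g _).symm
          exact map_zero _ }

lemma hom_ext_comp {M N : FDMod k (linCat k n)} {φ ψ : M ⟶ N}
    (h : ∀ c x, comp φ c x = comp ψ c x) : φ = ψ :=
  ObjectProperty.hom_ext _ (NatTrans.ext (funext fun c =>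
    ModuleCat.hom_ext (LinearMap.ext fun x => h (LinQuiver.vertex c) x)))

/-- An isomorphism is a family of linear isomorphisms that commute with the paths. -/
def isoOfAct {M N : FDMod k (linCat k n)} (φ : ∀ c, val M c ≃ₗ[k] val N c)
    (hφ : ∀ {c d : NN (n - 1)} (h : c ≤ d) (x : val M c), φ d (act M h x) = act N h (φ c x)) :
    M ≅ N where
  hom := homOfAct (fun c => (φ c).toLinearMap) hφ
  inv := homOfAct (fun c => (φ c).symm.toLinearMap) fun {c d} h x => by
    refine (φ d).injective ?_
    change φ d ((φ d).symm _) = φ d (act M h ((φ c).symm x))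
    rw [hφ, LinearEquiv.apply_symm_apply, LinearEquiv.apply_symm_apply]
  hom_inv_id := hom_ext_comp fun c x => (φ c).symm_apply_apply x
  inv_hom_id := hom_ext_comp fun c x => (φ c).apply_symm_apply x

/-- A submodule is a family of subspaces stable under the paths. -/
def submodOfAct {M : FDMod k (linCat k n)} (S : ∀ c, Submodule k (val M c))
    (hS : ∀ {c d : NN (n - 1)} (h : c ≤ d) {x : val M c}, x ∈ S c → act M h x ∈ S d) :
    Submod M where
  carrier c := S (LinQuiver.vertex c)
  map_mem {c d} g x hx := by
    by_cases h : LinQuiver.vertex c ≤ LinQuiver.vertex d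
    · exact (map_apply M h g x).symm ▸ Submodule.smul_mem _ _ (hS h hx)
    · exact (map_apply_of_not_le M h g x).symm ▸ Submodule.zero_mem _

/-- The part of a submodule at a vertex. -/
abbrev Submod.at {M : FDMod k (linCat k n)} (S : Submod M) (c : NN (n - 1)) :
    Submodule k (val M c) := S.carrier (vert k c)

lemma Submod.act_mem {M : FDMod k (linCat k n)} (S : Submod M) {c d : NN (n - 1)} (h : c ≤ d)
    {x : val M c} (hx : x ∈ S.at c) : act M h x ∈ S.at d := S.map_mem _ hx

lemma Submod.ext_at {M : FDMod k (linCat k n)} {S T : Submod M} (h : ∀ c, S.at c = T.at c) :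
    S = T :=
  Submod.ext (funext fun c => h (LinQuiver.vertex c))

/-! ### The injective modules -/

/-- The value of `I_c` at `d` is the dual of the space of morphisms from `d` to `c`. -/
def injDual (c d : NN (n - 1)) :
    val (inj k (linCat k n) (vert k c)) d ≃ₗ[k] Module.Dual k (vert k d ⟶ vert k c) :=
  LinearEquiv.refl k (Module.Dual k (vert k d ⟶ vert k c))

/-- The coordinate on `I_c` at `d`: the value of a functional at the path from `d` to `c`. -/
def injCoord {d c : NN (n - 1)} (h : d ≤ c) : val (inj k (linCat k n) (vert k c)) d →ₗ[k] k :=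
  LinearMap.applyₗ (arr k h) ∘ₗ (injDual c d).toLinearMap

/-- The element of `I_c` at `d` with coordinate `1`. -/
def injGen {d c : NN (n - 1)} (h : d ≤ c) : val (inj k (linCat k n) (vert k c)) d :=
  (injDual c d).symm (coeff h)

lemma injCoord_injGen {d c : NN (n - 1)} (h : d ≤ c) : injCoord h (injGen (k := k) h) = 1 :=
  coeff_arr h

lemma eq_injCoord_smul {d c : NN (n - 1)} (h : d ≤ c)
    (x : val (inj k (linCat k n) (vert k c)) d) : x = injCoord h x • injGen h := by
  refine (injDual c d).injective (LinearMap.ext fun g => ?_)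
  rw [map_smul, LinearMap.smul_apply]
  conv_lhs => rw [eq_coeff_smul_arr h g, map_smul]
  exact mul_comm _ _

lemma inj_eq_zero {d c : NN (n - 1)} (h : ¬ d ≤ c)
    (x : val (inj k (linCat k n) (vert k c)) d) : x = 0 := by
  refine (injDual c d).injective (LinearMap.ext fun g => ?_)
  rw [hom_eq_zero h g, map_zero, map_zero]

/-- A composite of paths is the path, so the left action is the identity in coordinates;
`injCoord_injRight` is the same fact for the right action. -/
lemma injCoord_act {d d' c : NN (n - 1)} (h : d ≤ d') (h' : d' ≤ c)
    (x : val (inj k (linCat k n) (vert k c)) d) :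
    injCoord h' (act _ h x) = injCoord (h.trans h') x := by
  change injDual c d x (arr k h ≫ arr k h') = _
  rw [arr_comp]
  rfl

/-- The right action of a path on `I`. -/
def injRight {c c' : NN (n - 1)} (h : c' ≤ c) :
    inj k (linCat k n) (vert k c) ⟶ inj k (linCat k n) (vert k c') :=
  (injBimod k (linCat k n)).obj.map (arr k h).op

lemma injCoord_injRight {d c c' : NN (n - 1)} (h : c' ≤ c) (h' : d ≤ c')
    (x : val (inj k (linCat k n) (vert k c)) d) :
    injCoord h' (comp (injRight h) d x) = injCoord (h'.trans h) x := by
  change injDual c d x (arr k h' ≫ arr k h) = _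
  rw [arr_comp]
  rfl

end LinMod


/-! ### Simple modules, socles, and thresholds of submodules of `I_c` -/

section Simple

variable {k : Type u} [Field k] {n : ℕ}

/-! ### Modules concentrated at a vertex -/

/-- A module of dimension one that is concentrated at the vertex `v`. -/
def IsSimpleAt (v : NN (n - 1)) (M : FDMod k (linCat k n)) : Prop :=
  (∀ c, c ≠ v → ∀ x : val M c, x = 0) ∧ Module.finrank k (val M v) = 1

/-- A homomorphism from a module concentrated at a vertex. -/
def homOfVertex {M N : FDMod k (linCat k n)} {v : NN (n - 1)}
    (hM : ∀ c, c ≠ v → ∀ x : val M c, x = 0) (l : val M v →ₗ[k] val N v)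
    (hl : ∀ d (h : v ≤ d), v ≠ d → ∀ x, act N h (l x) = 0) : M ⟶ N :=
  homOfAct (fun c => if h : c = v then (by subst h; exact l) else 0) fun {c d} h x => by
    by_cases hc : c = v
    · subst hc
      by_cases hd : d = c
      · subst hd
        simp only [dite_true]
        rw [act_refl, act_refl]
      · have h0 : act M h x = 0 := hM d hd _
        rw [h0, map_zero]
        simp only [dite_true]
        exact (hl d h (Ne.symm hd) x).symm
    · obtain rfl := hM c hc x
      simp only [map_zero]

lemma comp_homOfVertex {M N : FDMod k (linCat k n)} {v : NN (n - 1)}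
    (hM : ∀ c, c ≠ v → ∀ x : val M c, x = 0) (l : val M v →ₗ[k] val N v)
    (hl : ∀ d (h : v ≤ d), v ≠ d → ∀ x, act N h (l x) = 0) :
    comp (homOfVertex hM l hl) v = l := dif_pos rfl

lemma IsSimpleAt.nonempty_iso {v : NN (n - 1)} {M N : FDMod k (linCat k n)}
    (hM : IsSimpleAt v M) (hN : IsSimpleAt v N) : Nonempty (M ≅ N) := by
  have := Module.finite_of_finrank_eq_succ hM.2
  have := Module.finite_of_finrank_eq_succ hN.2
  let e : val M v ≃ₗ[k] val N v := LinearEquiv.ofFinrankEq _ _ (hM.2.trans hN.2.symm)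
  have h1 : ∀ d (h : v ≤ d), v ≠ d → ∀ x, act N h (e.toLinearMap x) = 0 :=
    fun d _ hd _ => hN.1 d hd.symm _
  have h2 : ∀ d (h : v ≤ d), v ≠ d → ∀ x, act M h (e.symm.toLinearMap x) = 0 :=
    fun d _ hd _ => hM.1 d hd.symm _
  refine ⟨⟨homOfVertex hM.1 e.toLinearMap h1, homOfVertex hN.1 e.symm.toLinearMap h2,
    hom_ext_comp fun c x => ?_, hom_ext_comp fun c x => ?_⟩⟩
  · by_cases hc : c = v
    · subst hc
      change comp (homOfVertex hN.1 _ h2) c (comp (homOfVertex hM.1 _ h1) c x) = x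
      rw [comp_homOfVertex, comp_homOfVertex]
      exact e.symm_apply_apply x
    · exact (hM.1 c hc _).trans (hM.1 c hc _).symm
  · by_cases hc : c = v
    · subst hc
      change comp (homOfVertex hM.1 _ h1) c (comp (homOfVertex hN.1 _ h2) c x) = x
      rw [comp_homOfVertex, comp_homOfVertex]
      exact e.apply_symm_apply x
    · exact (hN.1 c hc _).trans (hN.1 c hc _).symm

/-- Used to show that the socle of a quotient of `I_c` determines its vertex, so that `t_c` is well
defined. -/
lemma IsSimpleAt.eq_of_iso {v w : NN (n - 1)} {M N : FDMod k (linCat k n)}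
    (hM : IsSimpleAt v M) (hN : IsSimpleAt w N) (e : M ≅ N) : v = w := by
  by_contra hvw
  have := Module.nontrivial_of_finrank_pos (R := k) (hM.2 ▸ Nat.one_pos)
  obtain ⟨x, hx⟩ := exists_ne (0 : val M v)
  refine hx ?_
  have h1 : comp e.inv v (comp e.hom v x) = x :=
    congrArg (fun φ : M ⟶ M => comp φ v x) e.hom_inv_id
  rw [← h1, hN.1 v hvw (comp e.hom v x), map_zero]

/-! ### The simple modules -/

lemma at_eq_top_of_mem {M : FDMod k (linCat k n)} {v : NN (n - 1)}
    (hv : Module.finrank k (val M v) = 1) (S : Submod M) {x : val M v}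
    (hx : x ∈ S.at v) (hx0 : x ≠ 0) : S.at v = ⊤ := by
  refine eq_top_iff.mpr fun y _ => ?_
  obtain ⟨r, rfl⟩ := exists_smul_eq_of_finrank_eq_one hv hx0 y
  exact Submodule.smul_mem _ _ hx

lemma arr_ne_zero {c d : NN (n - 1)} (h : c ≤ d) : arr k h ≠ 0 := fun h0 =>
  zero_ne_one (α := k) (((coeff_arr h).symm.trans (congrArg _ h0)).trans (map_zero _)).symm

lemma finrank_hom {c d : NN (n - 1)} (h : c ≤ d) :
    Module.finrank k (vert k c ⟶ vert k d) = 1 :=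
  finrank_eq_one (arr k h) (arr_ne_zero h)
    fun w => ⟨coeff h w, (eq_coeff_smul_arr _ _).symm⟩

lemma finrank_proj {c d : NN (n - 1)} (h : c ≤ d) :
    Module.finrank k (val (proj k (linCat k n) (vert k c)) d) = 1 := finrank_hom h

/-- `P_v` is a line at `v`, spanned by the identity, and the identity generates `P_v`. -/
lemma proj_submod_eq_top {v : NN (n - 1)} (S : Submod (proj k (linCat k n) (vert k v)))
    {x : val (proj k (linCat k n) (vert k v)) v} (hx : x ∈ S.at v) (hx0 : x ≠ 0) : S = ⊤ := by
  have hid : 𝟙 (vert k v) ∈ S.at v :=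
    Submodule.eq_top_iff'.mp (at_eq_top_of_mem (finrank_proj le_rfl) S hx hx0) _
  refine Submod.ext_at fun c => eq_top_iff.mpr fun (x : vert k v ⟶ vert k c) _ => ?_
  have := S.map_mem x hid
  rwa [show ((proj k (linCat k n) (vert k v)).obj.map x).hom (𝟙 (vert k v)) = x from
    Category.id_comp x] at this

/-- The submodule of `P_v` spanned by the paths of positive length. -/
def projRad (v : NN (n - 1)) : Submod (proj k (linCat k n) (vert k v)) :=
  submodOfAct (fun c => if c = v then ⊥ else ⊤) fun {c d} h x hx => by
    by_cases hd : d = v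
    · subst hd
      by_cases hc : c = d
      · subst hc
        rw [act_refl]
        exact hx
      · have hx0 : x = 0 := hom_eq_zero (fun h' => hc (le_antisymm h h')) _
        rw [hx0, map_zero]
        exact Submodule.zero_mem _
    · rw [if_neg hd]
      exact Submodule.mem_top

lemma projRad_at_self (v : NN (n - 1)) : (projRad (k := k) v).at v = ⊥ := if_pos rfl

lemma projRad_at_of_ne {v c : NN (n - 1)} (h : c ≠ v) : (projRad (k := k) v).at c = ⊤ := if_neg h

/-- A proper submodule must vanish at `v`. Thus `projRad v` is the greatest proper submodule, hence
the only maximal one and equal to the radical. -/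
lemma le_projRad {v : NN (n - 1)} {S : Submod (proj k (linCat k n) (vert k v))} (hS : S ≠ ⊤) :
    S ≤ projRad v := by
  intro (c : linCat k n) x hx
  by_cases hc : LinQuiver.vertex c = v
  · subst hc
    by_contra h0
    refine hS (proj_submod_eq_top S hx fun hx0 => h0 ?_)
    subst hx0
    exact Submodule.zero_mem _
  · exact Submodule.eq_top_iff'.mp (projRad_at_of_ne hc) x

lemma isCoatom_projRad (v : NN (n - 1)) : IsCoatom (projRad (k := k) v) := by
  refine ⟨fun h => ?_, fun T hT => by_contra fun h => hT.not_ge (le_projRad h)⟩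
  have h1 : (projRad (k := k) v).at v = ⊤ := by rw [h]; rfl
  have := Module.nontrivial_of_finrank_pos (R := k) (Nat.one_pos.trans_eq (finrank_proj (k := k) (le_refl v)).symm)
  exact bot_ne_top ((projRad_at_self v).symm.trans h1)

lemma radical_proj (v : NN (n - 1)) :
    radical (proj k (linCat k n) (vert k v)) = projRad v := by
  refine le_antisymm (fun c => iInf_le
    (fun S : {S : Submod (proj k (linCat k n) (vert k v)) // IsCoatom S} => S.1.carrier c)
    ⟨_, isCoatom_projRad v⟩) fun c => le_iInf fun S => ?_
  have : S.1 = projRad v := (S.2.le_iff_eq (isCoatom_projRad v).1).mp (le_projRad S.2.1) |>.symm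
  exact (congrArg (fun T => T.carrier c) this).ge

lemma isSimpleAt_simple (v : NN (n - 1)) :
    IsSimpleAt v (simple k (linCat k n) (vert k v)) := by
  rw [simple, top, radical_proj]
  refine ⟨fun c hc x => ?_, ?_⟩
  · have : (projRad (k := k) v).at c = ⊤ := projRad_at_of_ne hc
    obtain ⟨x, rfl⟩ := Submodule.Quotient.mk_surjective _ x
    exact (Submodule.Quotient.mk_eq_zero _).mpr (Submodule.eq_top_iff'.mp this x)
  · have e := Submodule.quotEquivOfEqBot _ (projRad_at_self (k := k) v)
    exact e.finrank_eq.trans (finrank_proj le_rfl)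

/-! ### Modules with simple socle -/

/-- The submodule given by the value at a vertex on which all nontrivial paths act by zero. -/
def vertexSubmod (M : FDMod k (linCat k n)) (v : NN (n - 1))
    (h : ∀ d (hd : v ≤ d), v ≠ d → ∀ x, act M hd x = 0) : Submod M :=
  submodOfAct (fun c => if c = v then ⊤ else ⊥) fun {c d} hcd x hx => by
    by_cases hc : c = v
    · subst hc
      by_cases hd : d = c
      · rw [if_pos hd]
        exact Submodule.mem_top
      · rw [h d hcd (Ne.symm hd) x]
        exact Submodule.zero_mem _
    · rw [if_neg hc, Submodule.mem_bot] at hx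
      rw [hx, map_zero]
      exact Submodule.zero_mem _

section VertexSubmod

variable {M : FDMod k (linCat k n)} {v : NN (n - 1)}
  {h : ∀ d (hd : v ≤ d), v ≠ d → ∀ x, act M hd x = 0}

lemma vertexSubmod_at_self : (vertexSubmod M v h).at v = ⊤ := if_pos rfl

lemma vertexSubmod_at_of_ne {c : NN (n - 1)} (hc : c ≠ v) : (vertexSubmod M v h).at c = ⊥ :=
  if_neg hc

lemma vertexSubmod_le {S : Submod M} (hS : S.at v = ⊤) : vertexSubmod M v h ≤ S := by
  intro (c : linCat k n)
  by_cases hc : LinQuiver.vertex c = v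
  · subst hc
    exact le_top.trans_eq hS.symm
  · exact (vertexSubmod_at_of_ne hc).trans_le bot_le

lemma isSimpleAt_vertexSubmod (hv : Module.finrank k (val M v) = 1) :
    IsSimpleAt v (vertexSubmod M v h).toMod := by
  refine ⟨fun c hc x => Subtype.ext ?_, ?_⟩
  · have hx : x.1 ∈ (vertexSubmod M v h).at c := x.2
    rwa [vertexSubmod_at_of_ne hc, Submodule.mem_bot] at hx
  · refine (LinearEquiv.finrank_eq (LinearEquiv.ofTop _ vertexSubmod_at_self)).trans hv

lemma isAtom_vertexSubmod (hv : Module.finrank k (val M v) = 1) :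
    IsAtom (vertexSubmod M v h) := by
  have := Module.nontrivial_of_finrank_pos (R := k) (hv ▸ Nat.one_pos)
  refine ⟨fun h0 => ?_, fun T hT => ?_⟩
  · have h1 := vertexSubmod_at_self (h := h)
    rw [h0] at h1
    exact bot_ne_top h1
  · refine Submod.ext_at fun c => eq_bot_iff.mpr fun x hx => ?_
    by_cases hc : c = v
    · subst hc
      by_contra hx0
      exact hT.not_ge (vertexSubmod_le (at_eq_top_of_mem hv T hx hx0))
    · exact (vertexSubmod_at_of_ne (h := h) hc).le (hT.le (vert k c) hx)

end VertexSubmod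

/-- Any nonzero element can be pushed injectively to the line at `v`, so every nonzero submodule
contains that line. The line is thus the only simple submodule. -/
lemma isSimpleAt_socle {M : FDMod k (linCat k n)} {v : NN (n - 1)}
    (h0 : ∀ c, ¬ c ≤ v → ∀ x : val M c, x = 0)
    (hinj : ∀ c (h : c ≤ v) (x : val M c), act M h x = 0 → x = 0)
    (hv : Module.finrank k (val M v) = 1) : IsSimpleAt v (socle M).toMod := by
  have h : ∀ d (hd : v ≤ d), v ≠ d → ∀ x, act M hd x = 0 :=
    fun d hd hne x => h0 d (fun h' => hne (le_antisymm hd h')) _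
  suffices hs : socle M = vertexSubmod M v h from hs ▸ isSimpleAt_vertexSubmod hv
  have hA := isAtom_vertexSubmod (h := h) hv
  refine le_antisymm (fun c => iSup_le fun S => ?_) fun c => le_iSup
    (fun S : {S : Submod M // IsAtom S} => S.1.carrier c) ⟨_, hA⟩
  suffices hS : vertexSubmod M v h = S.1 from hS ▸ le_rfl
  refine (S.2.le_iff_eq hA.1).mp (vertexSubmod_le ?_)
  obtain ⟨c, x, hx, hx0⟩ : ∃ (c : NN (n - 1)) (x : val M c), x ∈ S.1.at c ∧ x ≠ 0 := by
    by_contra! hcon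
    exact S.2.1 (Submod.ext_at fun c => eq_bot_iff.mpr fun x hx => hcon c x hx)
  have hc : c ≤ v := by_contra fun hc => hx0 (h0 c hc x)
  exact at_eq_top_of_mem hv S.1 (S.1.act_mem hc hx) fun h' => hx0 (hinj c hc x h')

/-! ### Submodules of the injective modules -/

lemma injGen_ne_zero {d c : NN (n - 1)} (h : d ≤ c) : injGen (k := k) h ≠ 0 := fun h0 => by
  have := injCoord_injGen (k := k) h
  rw [h0, map_zero] at this
  exact zero_ne_one this

lemma eq_zero_of_injCoord {d c : NN (n - 1)} (h : d ≤ c)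
    {x : val (inj k (linCat k n) (vert k c)) d} (hx : injCoord h x = 0) : x = 0 := by
  rw [eq_injCoord_smul h x, hx, zero_smul]

lemma finrank_inj {d c : NN (n - 1)} (h : d ≤ c) :
    Module.finrank k (val (inj k (linCat k n) (vert k c)) d) = 1 :=
  finrank_eq_one _ (injGen_ne_zero h) fun w => ⟨injCoord h w, (eq_injCoord_smul h w).symm⟩

lemma inj_act_injective {d d' c : NN (n - 1)} (h : d ≤ d') (h' : d' ≤ c)
    {x : val (inj k (linCat k n) (vert k c)) d} (hx : act _ h x = 0) : x = 0 := by
  refine eq_zero_of_injCoord (h.trans h') ?_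
  rw [← injCoord_act h h', hx, map_zero]

lemma inj_at_eq_bot_or_top {d c : NN (n - 1)} (h : d ≤ c)
    (S : Submod (inj k (linCat k n) (vert k c))) : S.at d = ⊥ ∨ S.at d = ⊤ := by
  refine or_iff_not_imp_left.mpr fun hS => ?_
  obtain ⟨x, hx, hx0⟩ := Submodule.exists_mem_ne_zero_of_ne_bot hS
  exact at_eq_top_of_mem (finrank_inj h) S hx hx0

/-- Paths between lines of `I_c` are injective, so a submodule containing one line contains the
later ones. This forces the threshold shape. -/
lemma inj_at_eq_top_of_le {d d' c : NN (n - 1)} (h : d ≤ d') (h' : d' ≤ c)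
    {S : Submod (inj k (linCat k n) (vert k c))} (hS : S.at d = ⊤) : S.at d' = ⊤ :=
  at_eq_top_of_mem (finrank_inj h') S
    (S.act_mem h (hS ▸ Submodule.mem_top : injGen (h.trans h') ∈ S.at d))
    fun h0 => injGen_ne_zero _ (inj_act_injective h h' h0)

/-- A submodule of `I_c` vanishes at the vertices up to `s` and is everything above `s`. -/
def IsCut {c : NN (n - 1)} (S : Submod (inj k (linCat k n) (vert k c))) (s : ℕ) : Prop :=
  ∀ d : NN (n - 1), ((d : ℕ) ≤ s → S.at d = ⊥) ∧ (s < d → S.at d = ⊤)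

lemma exists_isCut {c : NN (n - 1)} (S : Submod (inj k (linCat k n) (vert k c))) :
    ∃ s ≤ (c : ℕ), IsCut S s := by
  have hex : ∃ s : ℕ, ∀ d : NN (n - 1), s < d → S.at d = ⊤ :=
    ⟨c, fun d hd => eq_top_iff.mpr fun x _ =>
      (inj_eq_zero (not_le.mpr hd : ¬ d ≤ c) x) ▸ Submodule.zero_mem _⟩
  have hle : Nat.find hex ≤ c := Nat.find_min' hex fun d hd => eq_top_iff.mpr fun x _ =>
      (inj_eq_zero (not_le.mpr hd : ¬ d ≤ c) x) ▸ Submodule.zero_mem _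
  refine ⟨Nat.find hex, hle, fun d => ⟨fun hd => ?_, fun hd => Nat.find_spec hex d hd⟩⟩
  have hdc : d ≤ c := hd.trans hle
  refine (inj_at_eq_bot_or_top hdc S).resolve_right fun htop => ?_
  have hd1 := d.2.1
  -- If the line at `d ≤ s` were contained in `S`, then `d - 1` would already serve as a threshold,
  -- against the minimality of `s`.
  refine Nat.find_min hex (m := d - 1) (by omega) fun d' hd' => ?_
  by_cases hc : d' ≤ c
  · refine inj_at_eq_top_of_le (d := d) (?_ : (d : ℕ) ≤ d') hc htop
    omega
  · exact eq_top_iff.mpr fun x _ => (inj_eq_zero hc x) ▸ Submodule.zero_mem _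

lemma IsCut.eq {c : NN (n - 1)} {S T : Submod (inj k (linCat k n) (vert k c))} {s : ℕ}
    (hS : IsCut S s) (hT : IsCut T s) : S = T :=
  Submod.ext_at fun d => (le_or_gt (d : ℕ) s).elim
    (fun h => ((hS d).1 h).trans ((hT d).1 h).symm)
    (fun h => ((hS d).2 h).trans ((hT d).2 h).symm)

/-- The bound `s ≤ c` matters: above `c` the module `I_c` is zero and thresholds would not be
unique. With it, a positive `s` is a vertex at which `I_c` is nonzero and `S` vanishes. -/
lemma IsCut.eq_top_iff {c : NN (n - 1)} {S : Submod (inj k (linCat k n) (vert k c))} {s : ℕ}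
    (hs : s ≤ c) (hS : IsCut S s) : S = ⊤ ↔ s = 0 := by
  constructor
  · rintro rfl
    by_contra h0
    have hv : s ∈ Set.Icc 1 (n - 1) := ⟨Nat.one_le_iff_ne_zero.mpr h0, hs.trans c.2.2⟩
    have h1 := (hS ⟨s, hv⟩).1 le_rfl
    have h2 : injGen (k := k) (d := ⟨s, hv⟩) (c := c) hs ∈
      (⊤ : Submod (inj k (linCat k n) (vert k c))).at ⟨s, hv⟩ := Submodule.mem_top
    rw [h1] at h2
    exact injGen_ne_zero _ ((Submodule.mem_bot k).mp h2)
  · rintro rfl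
    exact Submod.ext_at fun d => (hS d).2 d.2.1

lemma IsCut.isSimpleAt_socle {c v : NN (n - 1)} {S : Submod (inj k (linCat k n) (vert k c))}
    (hv : v ≤ c) (hS : IsCut S v) : IsSimpleAt v (socle S.quot).toMod := by
  refine CatalanCat.isSimpleAt_socle (fun d hd x => ?_) (fun d hd x hx => ?_) ?_
  · obtain ⟨x, rfl⟩ := Submodule.Quotient.mk_surjective _ x
    exact (Submodule.Quotient.mk_eq_zero _).mpr
      (Submodule.eq_top_iff'.mp ((hS d).2 (not_le.mp hd)) x)
  · obtain ⟨x, rfl⟩ := Submodule.Quotient.mk_surjective _ x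
    have h1 : act _ hd x ∈ S.at v := (Submodule.Quotient.mk_eq_zero _).mp hx
    rw [(hS v).1 le_rfl, Submodule.mem_bot] at h1
    rw [inj_act_injective hd hv h1]
    exact map_zero (S.at d).mkQ
  · have e := Submodule.quotEquivOfEqBot _ ((hS v).1 le_rfl)
    exact e.finrank_eq.trans (finrank_inj hv)

/-- The convention `t_i = 0` for `X ∩ I_i = I_i` is what makes the socle index agree with the
threshold also when `s = 0`. -/
lemma isSocleIndex_iff {X : SubBimod (injBimod k (linCat k n))} {i : NN (n - 1)} {s t : ℕ}
    (hs : s ≤ i) (hX : IsCut (X.left (vert k i)) s) : IsSocleIndex X i t ↔ t = s := by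
  have htop := hX.eq_top_iff hs
  by_cases h0 : s = 0
  · subst h0
    have hX := htop.mpr rfl
    exact ⟨fun h => h.elim And.right fun h => (h.1 hX).elim, fun h => Or.inl ⟨hX, h⟩⟩
  · have hv : s ∈ Set.Icc 1 (n - 1) := ⟨Nat.one_le_iff_ne_zero.mpr h0, hs.trans i.2.2⟩
    have hS := IsCut.isSimpleAt_socle (v := ⟨s, hv⟩) hs hX
    constructor
    · rintro (⟨h, -⟩ | ⟨-, v, rfl, ⟨e⟩⟩)
      · exact (h0 (htop.mp h)).elim
      · exact (congrArg Subtype.val (hS.eq_of_iso (isSimpleAt_simple v) e)).symm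
    · rintro rfl
      exact Or.inr ⟨fun h => h0 (htop.mp h), ⟨t, hv⟩, rfl, hS.nonempty_iso (isSimpleAt_simple _)⟩

end Simple


/-! ### Thresholds of Catalan maps, subbimodules and traces -/

section Theta

variable {k : Type u} [Field k] {n : ℕ}

/-! ### The function on vertices attached to an element of the Catalan monoid -/

/-- The element `i + 1` of `{1, …, n}`. -/
def succVertex (i : NN (n - 1)) : NN n :=
  ⟨i + 1, Nat.le_add_left _ _, by have := i.2.1; have := i.2.2; omega⟩

/-- The number `f(i + 1) - 1`. -/
def theta (f : catalanMonoid n) (i : NN (n - 1)) : ℕ := (f.1 (succVertex i) : ℕ) - 1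

lemma theta_add_one (f : catalanMonoid n) (i : NN (n - 1)) :
    1 + theta f i = f.1 (succVertex i) := by
  have : 1 ≤ (f.1 (succVertex i) : ℕ) := (f.1 (succVertex i)).2.1
  rw [theta]
  omega

lemma theta_le (f : catalanMonoid n) (i : NN (n - 1)) : theta f i ≤ i := by
  have h1 : (f.1 (succVertex i) : ℕ) ≤ i + 1 := f.2.1 (succVertex i)
  rw [← theta_add_one] at h1
  omega

lemma theta_mono (f : catalanMonoid n) : Monotone (theta f) := fun i j h =>
  Nat.sub_le_sub_right (f.2.2 (succVertex i) (succVertex j)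
    (Nat.add_le_add_right (h : (i : ℕ) ≤ j) 1)) 1

lemma theta_one (i : NN (n - 1)) : theta 1 i = i := rfl

/-- By monotonicity the best `b` is `theta g c` itself, because `b + 1 = g(c+1)`. The right side is
the index condition that appears when limits are composed. -/
lemma le_theta_mul_iff (f g : catalanMonoid n) (c d : NN (n - 1)) :
    (d : ℕ) ≤ theta (f * g) c ↔ ∃ b : NN (n - 1), (d : ℕ) ≤ theta f b ∧ (b : ℕ) ≤ theta g c := by
  have hd := d.2.1
  have hfg : 1 + theta (f * g) c = f.1 (g.1 (succVertex c)) := theta_add_one (f * g) c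
  have hg := theta_add_one g c
  have hgc := theta_le g c
  constructor
  · intro h
    have h1 : (f.1 (g.1 (succVertex c)) : ℕ) ≤ g.1 (succVertex c) := f.2.1 _
    -- The shifted value is a genuine vertex: `f` is order-decreasing, so `1 ≤ d ≤ theta (f * g) c ≤
    -- theta g c`.
    have hb : theta g c ∈ Set.Icc 1 (n - 1) := ⟨by omega, hgc.trans c.2.2⟩
    refine ⟨⟨theta g c, hb⟩, ?_, le_rfl⟩
    have h2 := theta_add_one f ⟨theta g c, hb⟩
    have h3 : succVertex ⟨theta g c, hb⟩ = g.1 (succVertex c) :=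
      Subtype.ext ((add_comm _ _).trans hg)
    rw [h3] at h2
    omega
  · rintro ⟨b, hb, hbc⟩
    have h1 : f.1 (succVertex b) ≤ f.1 (g.1 (succVertex c)) := f.2.2 _ _ (by
      change (b : ℕ) + 1 ≤ g.1 (succVertex c)
      omega)
    have h2 := theta_add_one f b
    have h3 : (f.1 (succVertex b) : ℕ) ≤ f.1 (g.1 (succVertex c)) := h1
    omega

lemma theta_alpha (i c : NN (n - 1)) : theta (alpha i) c = if c = i then (c : ℕ) - 1 else c := by
  have h : (alpha i).1 (succVertex c) = if h : (c : ℕ) + 1 = i + 1 then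
    ⟨c + 1 - 1, by have := c.2.1; have := c.2.2; constructor <;> omega⟩ else succVertex c := rfl
  rw [theta, h]
  by_cases hc : c = i
  · subst hc
    rw [dif_pos rfl, if_pos rfl]
    rfl
  · rw [dif_neg fun h => hc (Subtype.ext (Nat.succ_injective h)), if_neg hc]
    rfl

/-! ### Subbimodules of the injective bimodule -/

lemma thetaEq_iff {X : SubBimod (injBimod k (linCat k n))} {f : catalanMonoid n} :
    ThetaEq X f ↔ ∀ i : NN (n - 1), IsCut (X.left (vert k i)) (theta f i) := by
  constructor
  · rintro ⟨-, h⟩ i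
    obtain ⟨t, ht, hf⟩ := h i (succVertex i) rfl
    obtain ⟨s, hs, hX⟩ := exists_isCut (X.left (vert k i))
    obtain rfl := (isSocleIndex_iff hs hX).mp ht
    rwa [show theta f i = t by have := theta_add_one f i; omega]
  · intro h
    refine ⟨fun j hj => le_antisymm ((show (f.1 j : ℕ) ≤ j from f.2.1 j).trans hj.le) (f.1 j).2.1,
      fun i j hj => ⟨theta f i, (isSocleIndex_iff (theta_le f i) (h i)).mpr rfl, ?_⟩⟩
    obtain rfl : j = succVertex i := Subtype.ext hj
    exact (theta_add_one f i).symm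

/-- The submodule of `I_c` that vanishes at the vertices up to `s`. -/
def cutSubmod (c : NN (n - 1)) (s : ℕ) : Submod (inj k (linCat k n) (vert k c)) :=
  submodOfAct (fun d => if (d : ℕ) ≤ s then ⊥ else ⊤) fun {d d'} h x hx => by
    by_cases hd' : (d' : ℕ) ≤ s
    · rw [if_pos ((show (d : ℕ) ≤ d' from h).trans hd'), Submodule.mem_bot] at hx
      rw [hx, map_zero]
      exact Submodule.zero_mem _
    · rw [if_neg hd']
      exact Submodule.mem_top

lemma isCut_cutSubmod (c : NN (n - 1)) (s : ℕ) : IsCut (cutSubmod (k := k) c s) s :=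
  fun _ => ⟨fun h => if_pos h, fun h => if_neg h.not_ge⟩

/-- The right action goes from `I_d` to `I_d'` with `d' ≤ d`. Monotonicity gives `t d' ≤ t d`, so
wherever the target submodule vanishes, the source submodule does too. -/
lemma injBimod_map_mem_cutSubmod {t : NN (n - 1) → ℕ} (ht : Monotone t) {c d d' : NN (n - 1)}
    (g : vert k d' ⟶ vert k d) {x : val (inj k (linCat k n) (vert k d)) c}
    (hx : x ∈ (cutSubmod d (t d)).at c) :
    comp ((injBimod k (linCat k n)).obj.map g.op) c x ∈ (cutSubmod d' (t d')).at c := by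
  by_cases hc : (c : ℕ) ≤ t d'
  · by_cases h : d' ≤ d
    · rw [(isCut_cutSubmod d (t d) c).1 (hc.trans (ht h)), Submodule.mem_bot] at hx
      rw [hx, map_zero]
      exact Submodule.zero_mem _
    · have := (injBimod k (linCat k n)).property.1
      have hg : (injBimod k (linCat k n)).obj.map g.op = 0 := by
        rw [show g.op = 0 from congrArg Quiver.Hom.op (hom_eq_zero h g), Functor.map_zero]
      rw [hg]
      exact Submodule.zero_mem _
  · exact Submodule.eq_top_iff'.mp (if_neg hc) _

/-- The subbimodule of `I` attached to a monotone function on vertices. -/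
def cutSubBimod {t : NN (n - 1) → ℕ} (ht : Monotone t) :
    SubBimod (injBimod k (linCat k n)) where
  left c := cutSubmod (LinQuiver.vertex c) (t (LinQuiver.vertex c))
  right_mem g _ _ hx := injBimod_map_mem_cutSubmod ht g hx

lemma existsUnique_thetaEq (f : catalanMonoid n) :
    ∃! X : SubBimod (injBimod k (linCat k n)), ThetaEq X f := by
  refine ⟨cutSubBimod (theta_mono f), thetaEq_iff.mpr fun i => isCut_cutSubmod i _,
    fun Y hY => SubBimod.ext (funext fun c => ?_)⟩
  exact (thetaEq_iff.mp hY (LinQuiver.vertex c)).eq (isCut_cutSubmod _ _)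

/-- The subbimodule given by the traces of a left module. -/
def traceSubBimod {C : Type} [Category.{u} C] [Preadditive C] [Linear k C]
    (L : FDMod k C) (B : FDBimod k C) : SubBimod B where
  left d := trace L (B.obj.obj (op d))
  right_mem g c _ hx := trace_map L (B.obj.map g.op) c _ hx

/-- Exhibits `G_v` as an instance of `Hom((I/X)^*, -)`, so one computation covers both sides of the
theorem. -/
lemma functorG_eq (v : NN (n - 1)) : functorG k (linCat k n) (vert k v) =
    homFunctor (dual (traceSubBimod (simple k (linCat k n) (vert k v))
      (injBimod k (linCat k n))).quot) := rfl

/-- The socle of `I_d` is its line at `d`, so the trace of `L_v` is that line if `d = v` and zero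
otherwise. The threshold accordingly drops from `d` to `d - 1` only at `d = v`. -/
lemma isCut_trace (v d : NN (n - 1)) :
    IsCut (trace (simple k (linCat k n) (vert k v)) (inj k (linCat k n) (vert k d)))
      (theta (alpha v) d) := by
  have hL := isSimpleAt_simple (k := k) v
  intro c
  rw [theta_alpha]
  have hd1 := d.2.1
  constructor
  · intro hc
    have hcd : c ≤ d := by
      change (c : ℕ) ≤ d
      split_ifs at hc <;> omega
    refine eq_bot_iff.mpr (iSup_le fun φ => ?_)
    rintro _ ⟨y, rfl⟩
    refine (Submodule.mem_bot k).mpr ?_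
    change comp φ c y = 0
    by_cases hcv : c = v
    · subst hcv
      have hdc : d ≠ c := by
        rintro rfl
        rw [if_pos rfl] at hc
        omega
      -- Here `c = v < d`: pushing the image on to `d` is injective, but it factors through `L_v` at
      -- `d`, which is zero.
      refine inj_act_injective hcd le_rfl ?_
      rw [← comp_act, hL.1 d hdc (act _ hcd y), map_zero]
    · rw [hL.1 c hcv y, map_zero]
  · intro hc
    refine eq_top_iff.mpr fun x _ => ?_
    by_cases hcd : c ≤ d
    · have hcd' : (c : ℕ) ≤ d := hcd
      obtain ⟨rfl, rfl⟩ : d = v ∧ c = d := by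
        split_ifs at hc with h
        · exact ⟨h, Subtype.ext (by omega)⟩
        · omega
      have hI := finrank_inj (k := k) (le_refl c)
      have := Module.finite_of_finrank_eq_succ hL.2
      have := Module.finite_of_finrank_eq_succ hI
      let e : val (simple k (linCat k n) (vert k c)) c ≃ₗ[k]
        val (inj k (linCat k n) (vert k c)) c := LinearEquiv.ofFinrankEq _ _ (hL.2.trans hI.symm)
      have he : ∀ d (h : c ≤ d), c ≠ d → ∀ x,
          act (inj k (linCat k n) (vert k c)) h (e.toLinearMap x) = 0 :=
        fun d h hd x => inj_eq_zero (fun h' => hd (le_antisymm h h')) _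
      refine Submodule.mem_iSup_of_mem (homOfVertex hL.1 e.toLinearMap he) ⟨e.symm x, ?_⟩
      change comp (homOfVertex hL.1 e.toLinearMap he) c (e.symm x) = x
      rw [comp_homOfVertex]
      exact e.apply_symm_apply x
    · rw [inj_eq_zero hcd x]
      exact Submodule.zero_mem _

end Theta


/-! ### Functors given by limits over thresholds -/

section Pull

variable {k : Type u} [Field k] {n : ℕ}

/-! ### Functors that are given by compatible families -/

/-- The datum that identifies `H M` at a vertex `d`, naturally in `M` and `d`, with the space of
families of elements of `M` at the vertices `c` with `d ≤ t c` that are compatible with the action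
of the paths. -/
structure PullData (t : NN (n - 1) → ℕ) (H : FDMod k (linCat k n) ⥤ FDMod k (linCat k n)) where
  ev {c d : NN (n - 1)} (h : (d : ℕ) ≤ t c) (M : FDMod k (linCat k n)) :
    val (H.obj M) d →ₗ[k] val M c
  ev_map {c d : NN (n - 1)} (h : (d : ℕ) ≤ t c) {M N : FDMod k (linCat k n)} (φ : M ⟶ N)
    (y : val (H.obj M) d) : ev h N (comp (H.map φ) d y) = comp φ c (ev h M y)
  act_ev {c c' d : NN (n - 1)} (h : (d : ℕ) ≤ t c) (h' : (d : ℕ) ≤ t c') (hc : c ≤ c')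
    (M : FDMod k (linCat k n)) (y : val (H.obj M) d) : act M hc (ev h M y) = ev h' M y
  ev_act {c d d' : NN (n - 1)} (h : (d : ℕ) ≤ t c) (h' : (d' : ℕ) ≤ t c) (hd : d ≤ d')
    (M : FDMod k (linCat k n)) (y : val (H.obj M) d) :
    ev h' M (act (H.obj M) hd y) = ev h M y
  existsUnique_ev (M : FDMod k (linCat k n)) (d : NN (n - 1))
    (x : ∀ c : NN (n - 1), (d : ℕ) ≤ t c → val M c)
    (hx : ∀ c c' (h : (d : ℕ) ≤ t c) (h' : (d : ℕ) ≤ t c') (hc : c ≤ c'),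
      act M hc (x c h) = x c' h') :
    ∃! y : val (H.obj M) d, ∀ c h, ev h M y = x c h

namespace PullData

variable {t t' t'' : NN (n - 1) → ℕ} {H H' : FDMod k (linCat k n) ⥤ FDMod k (linCat k n)}

lemma ext (P : PullData t H) {M : FDMod k (linCat k n)} {d : NN (n - 1)}
    {y y' : val (H.obj M) d} (h : ∀ c (h : (d : ℕ) ≤ t c), P.ev h M y = P.ev h M y') :
    y = y' :=
  (P.existsUnique_ev M d (fun _ h => P.ev h M y') fun _ _ h h' hc => P.act_ev h h' hc M y').unique
    h fun _ _ => rfl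

lemma exists_transfer (P : PullData t H) (P' : PullData t H') (M : FDMod k (linCat k n))
    (d : NN (n - 1)) (y : val (H.obj M) d) :
    ∃ y' : val (H'.obj M) d, ∀ c (h : (d : ℕ) ≤ t c), P'.ev h M y' = P.ev h M y :=
  (P'.existsUnique_ev M d (fun _ h => P.ev h M y) fun _ _ h h' hc => P.act_ev h h' hc M y).exists

/-- The comparison map between two functors given by the same compatible families. -/
def transfer (P : PullData t H) (P' : PullData t H') (M : FDMod k (linCat k n))
    (d : NN (n - 1)) : val (H.obj M) d →ₗ[k] val (H'.obj M) d where
  toFun y := (P.exists_transfer P' M d y).choose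
  map_add' y z := P'.ext fun c h => by
    rw [map_add, (P.exists_transfer P' M d _).choose_spec,
      (P.exists_transfer P' M d _).choose_spec, (P.exists_transfer P' M d _).choose_spec, map_add]
  map_smul' r y := P'.ext fun c h => by
    rw [map_smul, (P.exists_transfer P' M d _).choose_spec,
      (P.exists_transfer P' M d _).choose_spec, map_smul]
    rfl

@[simp]
lemma ev_transfer (P : PullData t H) (P' : PullData t H') (M : FDMod k (linCat k n))
    {c d : NN (n - 1)} (h : (d : ℕ) ≤ t c) (y : val (H.obj M) d) :
    P'.ev h M (P.transfer P' M d y) = P.ev h M y :=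
  (P.exists_transfer P' M d y).choose_spec c h

/-- A functor is determined up to isomorphism by its description by compatible families. -/
def natIso (P : PullData t H) (P' : PullData t H') : H ≅ H' :=
  NatIso.ofComponents
    (fun M => isoOfAct
      (fun d => LinearEquiv.ofLinearMap (P.transfer P' M d) (P'.transfer P M d)
        (LinearMap.ext fun y => P'.ext fun c h => by
          rw [LinearMap.comp_apply, ev_transfer, ev_transfer]; rfl)
        (LinearMap.ext fun y => P.ext fun c h => by
          rw [LinearMap.comp_apply, ev_transfer, ev_transfer]; rfl))
      fun {d d'} hd y => P'.ext fun c h => by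
        have h0 : (d : ℕ) ≤ t c := (show (d : ℕ) ≤ d' from hd).trans h
        rw [LinearEquiv.coe_ofLinearMap, LinearEquiv.coe_ofLinearMap, ev_transfer,
          P.ev_act h0 h, P'.ev_act h0 h, ev_transfer])
    fun {M N} φ => hom_ext_comp fun d y => P'.ext fun c h => by
      change P'.ev h N (P.transfer P' N d (comp (H.map φ) d y)) =
        P'.ev h N (comp (H'.map φ) d (P.transfer P' M d y))
      rw [ev_transfer, P.ev_map, P'.ev_map, ev_transfer]

variable (k) in
/-- The identity functor. -/
def refl (ht : ∀ c : NN (n - 1), t c = c) : PullData t (𝟭 (FDMod k (linCat k n))) where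
  ev {c d} h M := act M (h.trans_eq (ht c) : d ≤ c)
  ev_map {c d} h M N φ y := (comp_act φ (h.trans_eq (ht c) : d ≤ c) y).symm
  act_ev _ _ _ _ _ := act_act _ _ _ _
  ev_act _ _ _ _ _ := act_act _ _ _ _
  existsUnique_ev M d x hx := by
    -- The index set is `{c | d ≤ c}`, so a compatible family is determined by its member at the
    -- least index `d`.
    refine ⟨x d (ht d).ge, fun c h => hx _ _ _ _ _, fun y hy => ?_⟩
    rw [← hy d (ht d).ge]
    exact (act_refl M y).symm

/-- Two intermediate vertices are comparable, and the path between them can be moved from the outer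
evaluation to the inner one. This makes the evaluation of a composite independent of the chosen `b`.
-/
lemma ev_ev_eq (P : PullData t H) (P' : PullData t' H') (M : FDMod k (linCat k n))
    {b b' c d : NN (n - 1)} (hd : (d : ℕ) ≤ t b) (hb : (b : ℕ) ≤ t' c)
    (hd' : (d : ℕ) ≤ t b') (hb' : (b' : ℕ) ≤ t' c) (y : val (H.obj (H'.obj M)) d) :
    P'.ev hb M (P.ev hd _ y) = P'.ev hb' M (P.ev hd' _ y) := by
  rcases le_total b b' with h | h
  · rw [← P.act_ev hd hd' h, P'.ev_act hb hb' h]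
  · rw [← P.act_ev hd' hd h, P'.ev_act hb' hb h]

/-- The composition of two functors. -/
def trans (P : PullData t H) (P' : PullData t' H') (ht' : Monotone t')
    (htt : ∀ c d : NN (n - 1), (d : ℕ) ≤ t'' c ↔
      ∃ b : NN (n - 1), (d : ℕ) ≤ t b ∧ (b : ℕ) ≤ t' c) : PullData t'' (H' ⋙ H) where
  ev {c d} h M := P'.ev ((htt c d).mp h).choose_spec.2 M ∘ₗ
    P.ev ((htt c d).mp h).choose_spec.1 (H'.obj M)
  ev_map {c d} h M N φ y := by
    rw [LinearMap.comp_apply, LinearMap.comp_apply, ← P'.ev_map, ← P.ev_map]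
    rfl
  act_ev {c c' d} h h' hc M y := by
    have hb := ((htt c d).mp h).choose_spec
    rw [LinearMap.comp_apply, LinearMap.comp_apply,
      P'.act_ev hb.2 (hb.2.trans (ht' hc)) hc]
    exact P.ev_ev_eq P' M _ _ _ _ y
  ev_act {c d d'} h h' hd M y := by
    have hb := ((htt c d').mp h').choose_spec
    have h0 := (show (d : ℕ) ≤ d' from hd).trans hb.1
    rw [LinearMap.comp_apply, LinearMap.comp_apply]
    refine (congrArg _ (P.ev_act h0 hb.1 hd (H'.obj M) y)).trans ?_
    exact P.ev_ev_eq P' M _ _ _ _ y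
  existsUnique_ev M d x hx := by
    -- For each `b` with `d ≤ t b`, the part of the family over `{c | b ≤ t' c}` glues to an element
    -- `z b` of `H' M` at `b`. Uniqueness makes the `z b` compatible, so they glue once more under
    -- `H`.
    have hxb (b : NN (n - 1)) (hb : (d : ℕ) ≤ t b) :=
      P'.existsUnique_ev M b (fun c hc => x c ((htt c d).mpr ⟨b, hb, hc⟩))
        fun c c' h h' hc => hx _ _ _ _ _
    choose z hz hzu using hxb
    obtain ⟨y, hy, -⟩ := P.existsUnique_ev (H'.obj M) d z fun b b' h h' hb =>
      hzu b' h' _ fun c hc => by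
        have h0 := (show (b : ℕ) ≤ b' from hb).trans hc
        rw [P'.ev_act h0 hc hb]
        exact hz b h c h0
    refine ⟨y, fun c h => ?_, fun y' hy' => P.ext fun b hb => ?_⟩
    · rw [LinearMap.comp_apply, hy]
      exact hz _ _ c _
    · rw [hy b hb]
      refine hzu b hb _ fun c hc => ?_
      have h := (htt c d).mpr ⟨b, hb, hc⟩
      rw [← hy' c h]
      exact P.ev_ev_eq P' M _ _ _ _ y'

end PullData

/-! ### Homomorphisms from the dual of a quotient of the injective bimodule -/

section Quot

variable {X : SubBimod (injBimod k (linCat k n))} {t : NN (n - 1) → ℕ}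

lemma injRight_injGen {d c c' : NN (n - 1)} (h : c' ≤ c) (h' : d ≤ c') :
    comp (injRight h) d (injGen (k := k) (h'.trans h)) = injGen h' := by
  rw [eq_injCoord_smul h' (comp (injRight h) d _), injCoord_injRight, injCoord_injGen, one_smul]

variable (X) in
/-- The value of the dual of `I / X` at a pair of vertices. -/
def dualQuotVal (c d : NN (n - 1)) :
    val ((dual X.quot).obj.obj (op (vert k d))) c ≃ₗ[k]
      Module.Dual k (val (inj k (linCat k n) (vert k c)) d ⧸ (X.left (vert k c)).at d) :=
  LinearEquiv.refl k
    (Module.Dual k (val (inj k (linCat k n) (vert k c)) d ⧸ (X.left (vert k c)).at d))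

lemma dualQuotVal_act {c c' d : NN (n - 1)} (h : c ≤ c')
    (ξ : val ((dual X.quot).obj.obj (op (vert k d))) c)
    (x : val (inj k (linCat k n) (vert k c')) d) :
    dualQuotVal X c' d (act _ h ξ) (((X.left (vert k c')).at d).mkQ x) =
      dualQuotVal X c d ξ (((X.left (vert k c)).at d).mkQ (comp (injRight h) d x)) := rfl

lemma dualQuotVal_right {c d d' : NN (n - 1)} (h : d ≤ d')
    (ξ : val ((dual X.quot).obj.obj (op (vert k d'))) c)
    (x : val (inj k (linCat k n) (vert k c)) d) :
    dualQuotVal X c d (comp ((dual X.quot).obj.map (arr k h).op) c ξ)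
      (((X.left (vert k c)).at d).mkQ x) =
      dualQuotVal X c d' ξ (((X.left (vert k c)).at d').mkQ (act _ h x)) := rfl

lemma dualQuotVal_ext {c d : NN (n - 1)}
    {ξ η : val ((dual X.quot).obj.obj (op (vert k d))) c}
    (h : ∀ x, dualQuotVal X c d ξ (((X.left (vert k c)).at d).mkQ x) =
      dualQuotVal X c d η (((X.left (vert k c)).at d).mkQ x)) : ξ = η :=
  (dualQuotVal X c d).injective (LinearMap.ext fun x => by
    obtain ⟨x, rfl⟩ := ((X.left (vert k c)).at d).mkQ_surjective x
    exact h x)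

/-- The functional on `I / X` induced by the coordinate on `I`. -/
def dualQuotGen (ht : ∀ c, t c ≤ c) (hX : ∀ c, IsCut (X.left (vert k c)) (t c))
    {c d : NN (n - 1)} (h : (d : ℕ) ≤ t c) : val ((dual X.quot).obj.obj (op (vert k d))) c :=
  (dualQuotVal X c d).symm (Submodule.liftQ _ (injCoord (h.trans (ht c) : d ≤ c)) (by
    rw [(hX c d).1 h]
    exact bot_le))

lemma dualQuotVal_gen (ht : ∀ c, t c ≤ c) (hX : ∀ c, IsCut (X.left (vert k c)) (t c)) {c d : NN (n - 1)} (h : (d : ℕ) ≤ t c)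
    (x : val (inj k (linCat k n) (vert k c)) d) :
    dualQuotVal X c d (dualQuotGen ht hX h) (((X.left (vert k c)).at d).mkQ x) =
      injCoord (h.trans (ht c) : d ≤ c) x := rfl

/-- Below the threshold nothing is divided out, so `(I/X)^*` is there the dual of a line. Together
with `dualQuot_eq_zero` this describes all values of the bimodule. -/
lemma eq_smul_dualQuotGen (ht : ∀ c, t c ≤ c) (hX : ∀ c, IsCut (X.left (vert k c)) (t c))
    {c d : NN (n - 1)} (h : (d : ℕ) ≤ t c)
    (ξ : val ((dual X.quot).obj.obj (op (vert k d))) c) :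
    ξ = dualQuotVal X c d ξ (((X.left (vert k c)).at d).mkQ
      (injGen (h.trans (ht c) : d ≤ c))) • dualQuotGen ht hX h := by
  refine dualQuotVal_ext fun x => ?_
  rw [map_smul, LinearMap.smul_apply, dualQuotVal_gen]
  conv_lhs => rw [eq_injCoord_smul (h.trans (ht c) : d ≤ c) x, map_smul, map_smul]
  exact mul_comm _ _

lemma dualQuot_eq_zero (hX : ∀ c, IsCut (X.left (vert k c)) (t c)) {c d : NN (n - 1)} (h : ¬ (d : ℕ) ≤ t c)
    (ξ : val ((dual X.quot).obj.obj (op (vert k d))) c) : ξ = 0 := by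
  refine dualQuotVal_ext fun x => ?_
  have hx : ((X.left (vert k c)).at d).mkQ x = 0 := (Submodule.Quotient.mk_eq_zero _).mpr
    (Submodule.eq_top_iff'.mp ((hX c d).2 (not_le.mp h)) x)
  rw [hx, map_zero, map_zero]

/-- Since paths preserve coordinates on `I`, generators go to generators. Hence the images of the
generators under a homomorphism form a compatible family. -/
lemma act_dualQuotGen (ht : ∀ c, t c ≤ c) (hX : ∀ c, IsCut (X.left (vert k c)) (t c))
    {c c' d : NN (n - 1)} (h : (d : ℕ) ≤ t c) (h' : (d : ℕ) ≤ t c') (hc : c ≤ c') :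
    act _ hc (dualQuotGen ht hX h) = dualQuotGen ht hX h' := by
  refine dualQuotVal_ext fun x => ?_
  rw [dualQuotVal_act, dualQuotVal_gen, dualQuotVal_gen, injCoord_injRight]

lemma dualQuotGen_right (ht : ∀ c, t c ≤ c) (hX : ∀ c, IsCut (X.left (vert k c)) (t c))
    {c d d' : NN (n - 1)} (h : (d : ℕ) ≤ t c) (h' : (d' : ℕ) ≤ t c) (hd : d ≤ d') :
    comp ((dual X.quot).obj.map (arr k hd).op) c (dualQuotGen ht hX h') =
      dualQuotGen ht hX h := by
  refine dualQuotVal_ext fun x => ?_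
  rw [dualQuotVal_right, dualQuotVal_gen, dualQuotVal_gen, injCoord_act]

open Classical in
/-- The homomorphism from `(I / X)^*` attached to a compatible family. -/
def homOfFamily (ht : ∀ c, t c ≤ c) (hX : ∀ c, IsCut (X.left (vert k c)) (t c))
    (hmono : Monotone t) {M : FDMod k (linCat k n)} {d : NN (n - 1)}
    (x : ∀ c : NN (n - 1), (d : ℕ) ≤ t c → val M c)
    (hx : ∀ c c' (h : (d : ℕ) ≤ t c) (h' : (d : ℕ) ≤ t c') (hc : c ≤ c'),
      act M hc (x c h) = x c' h') :
    (dual X.quot).obj.obj (op (vert k d)) ⟶ M :=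
  homOfAct (fun c => if h : (d : ℕ) ≤ t c then
      (LinearMap.toSpanSingleton k _ (x c h)) ∘ₗ LinearMap.applyₗ
        (((X.left (vert k c)).at d).mkQ (injGen (h.trans (ht c) : d ≤ c))) ∘ₗ
        (dualQuotVal X c d).toLinearMap else 0)
    fun {c c'} hc ξ => by
      by_cases h : (d : ℕ) ≤ t c
      · have h' := h.trans (hmono hc)
        rw [dif_pos h, dif_pos h']
        change dualQuotVal X c' d (act _ hc ξ) _ • x c' h' =
          act M hc (dualQuotVal X c d ξ _ • x c h)
        rw [dualQuotVal_act, injRight_injGen hc, map_smul, hx c c' h h' hc]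
      · rw [dualQuot_eq_zero hX h ξ]
        simp only [map_zero]

lemma comp_homOfFamily (ht : ∀ c, t c ≤ c) (hX : ∀ c, IsCut (X.left (vert k c)) (t c))
    (hmono : Monotone t) {M : FDMod k (linCat k n)} {d : NN (n - 1)}
    (x : ∀ c : NN (n - 1), (d : ℕ) ≤ t c → val M c)
    (hx : ∀ c c' (h : (d : ℕ) ≤ t c) (h' : (d : ℕ) ≤ t c') (hc : c ≤ c'),
      act M hc (x c h) = x c' h') {c : NN (n - 1)} (h : (d : ℕ) ≤ t c)
    (ξ : val ((dual X.quot).obj.obj (op (vert k d))) c) :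
    comp (homOfFamily ht hX hmono x hx) c ξ = dualQuotVal X c d ξ
      (((X.left (vert k c)).at d).mkQ (injGen (h.trans (ht c) : d ≤ c))) • x c h := by
  have h0 : comp (homOfFamily ht hX hmono x hx) c =
    (LinearMap.toSpanSingleton k _ (x c h)) ∘ₗ LinearMap.applyₗ
      (((X.left (vert k c)).at d).mkQ (injGen (h.trans (ht c) : d ≤ c))) ∘ₗ
      (dualQuotVal X c d).toLinearMap := dif_pos h
  rw [h0]
  rfl

/-- The functor `Hom((I / X)^*, -)` is described by compatible families. -/
def pullDataQuot (ht : ∀ c, t c ≤ c) (hX : ∀ c, IsCut (X.left (vert k c)) (t c))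
    (hmono : Monotone t) : PullData t (homFunctor (dual X.quot)) where
  ev {c d} h M :=
    { toFun := fun φ : (dual X.quot).obj.obj (op (vert k d)) ⟶ M =>
        comp φ c (dualQuotGen ht hX h)
      map_add' := fun _ _ => rfl
      map_smul' := fun _ _ => rfl }
  ev_map _ _ _ _ _ := rfl
  act_ev {c c' d} h h' hc M (φ : (dual X.quot).obj.obj (op (vert k d)) ⟶ M) := by
    change act M hc (comp φ c (dualQuotGen ht hX h)) = comp φ c' (dualQuotGen ht hX h')
    rw [← comp_act, act_dualQuotGen]
  ev_act {c d d'} h h' hd M (φ : (dual X.quot).obj.obj (op (vert k d)) ⟶ M) := by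
    change comp φ c (comp ((dual X.quot).obj.map (arr k hd).op) c (dualQuotGen ht hX h')) =
      comp φ c (dualQuotGen ht hX h)
    rw [dualQuotGen_right]
  existsUnique_ev M d x hx := by
    refine ⟨homOfFamily ht hX hmono x hx, fun c h => ?_,
      fun (φ : (dual X.quot).obj.obj (op (vert k d)) ⟶ M) hφ => hom_ext_comp fun c ξ => ?_⟩
    · change comp (homOfFamily ht hX hmono x hx) c (dualQuotGen ht hX h) = x c h
      rw [comp_homOfFamily ht hX hmono x hx h, dualQuotVal_gen, injCoord_injGen, one_smul]
    · by_cases h : (d : ℕ) ≤ t c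
      · rw [comp_homOfFamily ht hX hmono x hx h, ← hφ c h]
        conv_lhs => rw [eq_smul_dualQuotGen ht hX h ξ, map_smul]
        rfl
      · rw [dualQuot_eq_zero hX h ξ, map_zero, map_zero]

end Quot

/-! ### Compositions of the functors `G_i` -/

variable (k) in
-- In the inductive step `G_v` is applied last and `alpha v` multiplies on the left, so the order in
-- `PullData.trans` matches right-to-left composition in the monoid.
lemma nonempty_pullData_compG (l : List (NN (n - 1))) :
    Nonempty (PullData (theta (l.map alpha).prod)
      (compG k (linCat k n) (l.map (vert k)))) := by
  induction l with
  | nil => exact ⟨PullData.refl k theta_one⟩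
  | cons v l ih =>
    obtain ⟨P⟩ := ih
    have Q : PullData (theta (alpha v)) (functorG k (linCat k n) (vert k v)) :=
      functorG_eq (k := k) v ▸ pullDataQuot (X := traceSubBimod _ _) (theta_le _) (isCut_trace v) (theta_mono _)
    exact ⟨Q.trans P (theta_mono _) fun c d => le_theta_mul_iff _ _ c d⟩

end Pull

end CatalanCat

end

theorem proposition7 (k : Type u) [Field k] [IsAlgClosed k] (n : ℕ) (hn : 1 ≤ n)
    (f : CatalanCat.catalanMonoid n) (l : List (CatalanCat.NN (n - 1)))
    (hf : f = (l.map CatalanCat.alpha).prod) :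
    (∃! X : CatalanCat.SubBimod (CatalanCat.injBimod k (CatalanCat.linCat k n)),
      CatalanCat.ThetaEq X f) ∧
    ∀ X : CatalanCat.SubBimod (CatalanCat.injBimod k (CatalanCat.linCat k n)),
      CatalanCat.ThetaEq X f →
      Nonempty (CatalanCat.compG k (CatalanCat.linCat k n) (l.map (CatalanCat.vert k)) ≅
        CatalanCat.homFunctor (CatalanCat.dual X.quot)) := by
  refine ⟨CatalanCat.existsUnique_thetaEq f, fun X hX => ?_⟩
  obtain ⟨P⟩ := CatalanCat.nonempty_pullData_compG k l
  subst hf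
  exact ⟨P.natIso (CatalanCat.pullDataQuot (CatalanCat.theta_le _)
    (CatalanCat.thetaEq_iff.mp hX) (CatalanCat.theta_mono _))⟩
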